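/- Fix $\theta\in(0,1)$, an integer $n\ge 3$, integers $\alpha_0,\dots,\alpha_n$ with $\alpha_n\neq 0$, and positive coprime integers $p,q$. Let $$A(\lambda)=\sum_{m=2}^{n}\alpha_m\sum_{k=2}^{m}\binom{m}{k}\theta^{m-k}\lambda^k ,$$ and consider on $[0,2\pi]\times[0,\infty)$ the periodic problem $$\partial_t z=-iA(-i\partial_x)z,\qquad z(x,0)=z_0(x),\qquad \partial_x^m z(0,t)=\partial_x^m z(2\pi,t)\quad (m=0,\dots,n-1),$$ with $z_0\in L^2(0,2\pi)$. A solution is understood in the weak sense: $z\in C([0,\infty);L^2(0,2\pi))$, $z(\cdot,0)=z_0$, and $$\frac{d}{dt}\langle z(\cdot,t),\varphi\rangle=\langle z(\cdot,t),\,iA(-i\partial_x)\varphi\rangle\qquad (t\ge 0)$$ for every $C^n$ function $\varphi$ with $\partial_x^m\varphi(0)=\partial_x^m\varphi(2\pi)$, $m=0,\dots,n-1$, where $\langle\cdot,\cdot\rangle$ is the inner product of $L^2(0,2\pi)$, linear in the first argument. For every $z_0\in L^2(0,2\pi)$ this problem has a unique solution $z$. At the rational time $t_r=2\pi\frac pq$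 it satisfies the following. (i) If $\theta\in\mathbb{Q}$, then $z(\cdot,t_r)$ is a finite linear combination of periodically translated copies of $z_0$: there are $N\in\mathbb{N}$, $c_1,\dots,c_N\in\mathbb{C}$ and $s_1,\dots,s_N\in\mathbb{R}$, not depending on $z_0$, such that $z(x,t_r)=\sum_{j=1}^N c_j\, z_0^{*}(x-s_j)$ for almost every $x\in(0,2\pi)$, where $z_0^{*}$ is the $2\pi$-periodic extension of $z_0$ to $\mathbb{R}$. (ii) If $\theta\notin\mathbb{Q}$ and $z_0$ is of bounded variation over $[0,2\pi]$, then $z(\cdot,t_r)$ is (almost everywhere equal to) a continuous function of $x\in[0,2\pi]$ with $z(0,t_r)=z(2\pi,t_r)$. -/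

import Mathlib

open MeasureTheory Set Polynomial

noncomputable section

/-- Lebesgue measure on the space interval of length `2π` (endpoints are null). -/
abbrev spaceMeasure : Measure ℝ := volume.restrict (Ioc 0 (2 * Real.pi))

/-- The Hilbert space `L²(0, 2π)` of complex-valued functions. -/
abbrev L2Space : Type := Lp ℂ 2 spaceMeasure

/-- The `2π`-periodic extension `f*` of a function `f` on `[0, 2π)`:
`f* x = f (x - 2πm)` for `2πm ≤ x < 2π(m+1)`. -/
def periodicExt (f : ℝ → ℂ) (x : ℝ) : ℂ :=
  f (toIcoMod Real.two_pi_pos 0 x)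

/-- Periodic translation `(T_s f)(x) = f*(x - s)`. -/
def periodicTranslate (s : ℝ) (f : ℝ → ℂ) (x : ℝ) : ℂ :=
  periodicExt f (x - s)

/-- The polynomial `A(λ) = ∑_{m=2}^n α_m ∑_{k=2}^m (m choose k) θ^(m-k) λ^k`. -/
def polyA (n : ℕ) (α : ℕ → ℤ) (θ : ℝ) : ℝ[X] :=
  ∑ m ∈ Finset.Icc 2 n, ∑ k ∈ Finset.Icc 2 m,
    C ((α m : ℝ) * (m.choose k : ℝ) * θ ^ (m - k)) * X ^ k

/-- The constant-coefficient differential operator `Q(-i ∂_x)` acting on a smooth enough `φ`. -/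
def diffOp (Q : ℝ[X]) (φ : ℝ → ℂ) (x : ℝ) : ℂ :=
  Q.sum fun k a => (a : ℂ) * ((-Complex.I) ^ k * iteratedDeriv k φ x)

/-- Test functions of order `n`: `n` times continuously differentiable functions satisfying the
periodic boundary conditions `∂^m φ(0) = ∂^m φ(2π)` for `m = 0, …, n-1`. -/
structure IsPeriodicTest (n : ℕ) (φ : ℝ → ℂ) : Prop where
  contDiff : ContDiff ℝ n φ
  boundary : ∀ m < n, iteratedDeriv m φ 0 = iteratedDeriv m φ (2 * Real.pi)

/-- `z` is a (weak) solution in `L²(0, 2π)`, for times `t ≥ 0`, of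
`∂_t z = -i Q(-i ∂_x) z`, `z(·, 0) = z₀`, with the periodic boundary conditions
`∂^m z(0, t) = ∂^m z(2π, t)`, `m < n`: it is strongly continuous in time, takes the initial value,
and `d/dt ⟨z(t), φ⟩ = ⟨z(t), (-i Q(-i ∂_x))^* φ⟩ = ⟨z(t), i Q(-i ∂_x) φ⟩` for every periodic test
function `φ` (the derivative being one-sided at `t = 0`). -/
structure IsPeriodicSolution (n : ℕ) (Q : ℝ[X]) (z₀ : L2Space) (z : ℝ → L2Space) : Prop where
  continuousOn : ContinuousOn z (Ici 0)
  initial : z 0 = z₀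
  weak : ∀ φ : ℝ → ℂ, IsPeriodicTest n φ → ∀ t : ℝ, 0 ≤ t →
    HasDerivWithinAt
      (fun s : ℝ => ∫ x in Ioc 0 (2 * Real.pi), z s x * (starRingEnd ℂ) (φ x))
      (∫ x in Ioc 0 (2 * Real.pi), z t x * (starRingEnd ℂ) (Complex.I * diffOp Q φ x))
      (Ici 0) t

end

/-! Write e(x) = exp(2πix) and n = e + 2. Testing the weak equation against the modes exp(ijx) gives
one linear ODE per Fourier coefficient, so the solution is unique. It multiplies the j-th
coefficient by exp(-iA(j)t), which at the rational time is e(-(p/q)A(j)).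

If θ is rational, this multiplier is periodic in j. It is then a finite combination of characters
e(jl/V), each of which acts as a translation (`exists_translates_of_rational`).

Let θ be irrational. The two top coefficients of A are α_n and α_(n-1) + nα_nθ. On a residue class
mod q the integer contributions are constant mod 1, so the phase there has effective degree n-1 ≥ 2,
with (n-1)-th difference ±Bθ, where B is `phaseMultiplier` (`hasPhase_modePhase`). For initial data
of bounded variation, integration by parts bounds a symmetric block of the Fourier series by a
constant times the supremum over x of the sum of (u_j - u_(-j))/j, where u_j is the multiplier times
e(jx). It therefore suffices to find scales tending to infinity between which these suprema are
summable (`exists_scales`). The partial sums along the scales then converge uniformly, and the limit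
is the solution almost everywhere.

Weyl's inequality in inverse form (`exists_small_denominator_of_large_weyl_sum`) makes a dyadic
block at scale N of size O(1/K), unless some v ≤ K^C has vBθ within K^C/N^(n-1) of an integer. For K
= 2^i this exception stops at some scale, but for a Liouville-like θ the number of dyadic blocks
before K can be doubled is unbounded. In such a long stage, the rational approximation that still
exists at the next level replaces θ by a rational θ' in all but O(i) blocks. The new multiplier is
periodic, Weyl's inequality makes its discrete Fourier coefficients at most 1/K, and the symmetric
sum of a single character is bounded. A whole stage thus costs O(i/2^i)
(`exists_norm_symmSum_stage_le`), which is summable. -/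

/-! ### Additive characters and geometric sums -/

/-- The additive character `x ↦ exp (2πix)` of `ℝ/ℤ`. -/
noncomputable def unitExp (x : ℝ) : ℂ := Complex.exp ((2 * Real.pi * x : ℝ) * Complex.I)

theorem unitExp_add (x y : ℝ) : unitExp (x + y) = unitExp x * unitExp y := by
  rw [unitExp, unitExp, unitExp, ← Complex.exp_add]
  congr 1; push_cast; ring

@[simp] theorem norm_unitExp (x : ℝ) : ‖unitExp x‖ = 1 := Complex.norm_exp_ofReal_mul_I _

@[simp] theorem unitExp_intCast (m : ℤ) : unitExp m = 1 := by
  rw [unitExp, Complex.exp_eq_one_iff]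
  exact ⟨m, by push_cast; ring⟩

theorem unitExp_add_intCast (x : ℝ) (m : ℤ) : unitExp (x + m) = unitExp x := by
  rw [unitExp_add, unitExp_intCast, mul_one]

theorem conj_unitExp (x : ℝ) : (starRingEnd ℂ) (unitExp x) = unitExp (-x) := by
  rw [unitExp, unitExp, ← Complex.exp_conj]
  congr 1
  rw [map_mul, Complex.conj_ofReal, Complex.conj_I]; push_cast; ring

theorem unitExp_sub (x y : ℝ) : unitExp (x - y) = unitExp x * (starRingEnd ℂ) (unitExp y) := by
  rw [sub_eq_add_neg, unitExp_add, conj_unitExp]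

theorem unitExp_nat_mul (k : ℕ) (x : ℝ) : unitExp (k * x) = unitExp x ^ k := by
  rw [unitExp, unitExp, ← Complex.exp_nat_mul]; congr 1; push_cast; ring

theorem norm_unitExp_sub_one (x : ℝ) : ‖unitExp x - 1‖ = 2 * |Real.sin (Real.pi * x)| := by
  have := Complex.norm_exp_I_mul_ofReal_sub_one (2 * Real.pi * x)
  rw [unitExp, mul_comm, this, norm_mul, Real.norm_eq_abs, Real.norm_eq_abs, abs_two]
  congr 3; ring

theorem norm_unitExp_sub_one_le (x : ℝ) : ‖unitExp x - 1‖ ≤ 2 * Real.pi * |x| := by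
  rw [norm_unitExp_sub_one]
  have h := Real.abs_sin_le_abs (x := Real.pi * x)
  rw [abs_mul, abs_of_pos Real.pi_pos] at h
  linarith

theorem norm_unitExp_sub_le (x y : ℝ) : ‖unitExp x - unitExp y‖ ≤ 2 * Real.pi * |x - y| := by
  have h : unitExp x - unitExp y = unitExp y * (unitExp (x - y) - 1) := by
    rw [mul_sub, ← unitExp_add]; simp
  rw [h, norm_mul, norm_unitExp, one_mul]
  exact norm_unitExp_sub_one_le _

/-- Jordan's inequality |sin(πy)| ≥ 2|y| on |y| ≤ 1/2, after reduction mod 1. -/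
theorem four_mul_abs_sub_round_le (x : ℝ) : 4 * |x - round x| ≤ ‖unitExp x - 1‖ := by
  have h1 : unitExp x = unitExp (x - round x) := by
    rw [← unitExp_add_intCast (x - round x) (round x), sub_add_cancel]
  rw [h1, norm_unitExp_sub_one]
  set y := x - round x
  have hy : |y| ≤ 1 / 2 := abs_sub_round x
  have h2 := Real.mul_abs_le_abs_sin (x := Real.pi * y)
    (by rw [abs_mul, abs_of_pos Real.pi_pos]; nlinarith [Real.pi_pos])
  rw [abs_mul, abs_of_pos Real.pi_pos, ← mul_assoc, div_mul_cancel₀ _ Real.pi_pos.ne'] at h2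
  linarith

/-- Geometric sums of characters. -/
theorem abs_sub_round_mul_norm_sum_unitExp_le (x : ℝ) (L : ℕ) :
    |x - round x| * ‖∑ j ∈ Finset.range L, unitExp x ^ j‖ ≤ 1 / 2 := by
  have h := four_mul_abs_sub_round_le x
  have h1 : ‖unitExp x - 1‖ * ‖∑ j ∈ Finset.range L, unitExp x ^ j‖ ≤ 2 := by
    rw [← norm_mul, mul_comm, geom_sum_mul]
    refine (norm_sub_le _ _).trans ?_
    rw [norm_pow, norm_unitExp]; norm_num
  have h2 := mul_le_mul_of_nonneg_right h (norm_nonneg (∑ j ∈ Finset.range L, unitExp x ^ j))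
  linarith

/-! ### Polynomial phases modulo 1 -/

/-- `HasPhase d γ F`: the `d`-th forward difference of `F` is constantly `γ` modulo `1`. -/
def HasPhase : ℕ → ℝ → (ℕ → ℝ) → Prop
  | 0, γ, F => ∀ j, ∃ m : ℤ, F j = γ + m
  | d + 1, γ, F => HasPhase d γ (fun j => F (j + 1) - F j)

namespace HasPhase

theorem add {d : ℕ} {γ δ : ℝ} {F G : ℕ → ℝ} (hF : HasPhase d γ F) (hG : HasPhase d δ G) :
    HasPhase d (γ + δ) (fun j => F j + G j) := by
  induction d generalizing F G with
  | zero =>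
    intro j
    obtain ⟨a, ha⟩ := hF j
    obtain ⟨b, hb⟩ := hG j
    exact ⟨a + b, by simp only [ha, hb]; push_cast; ring⟩
  | succ d ih =>
    have := ih hF hG
    simp only [HasPhase]
    convert this using 2
    ring_nf

theorem of_intCast {d : ℕ} {F : ℕ → ℝ} (hF : ∀ j, ∃ m : ℤ, F j = m) : HasPhase d 0 F := by
  induction d generalizing F with
  | zero =>
    intro j
    obtain ⟨m, hm⟩ := hF j
    exact ⟨m, by simp [hm]⟩
  | succ d ih =>
    refine ih fun j => ?_
    obtain ⟨m, hm⟩ := hF j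
    obtain ⟨m', hm'⟩ := hF (j + 1)
    exact ⟨m' - m, by rw [hm, hm']; push_cast; ring⟩

theorem shift {d : ℕ} {γ : ℝ} {F : ℕ → ℝ} (hF : HasPhase d γ F) (h : ℕ) :
    HasPhase d γ (fun j => F (j + h)) := by
  induction d generalizing F with
  | zero => exact fun j => hF (j + h)
  | succ d ih =>
    have := ih hF
    simp only [HasPhase]
    convert this using 2
    ring_nf

/-- The difference over h telescopes into h unit differences, each with top difference γ. This is
the Weyl differencing step: the degree drops by one and γ becomes hγ. -/
theorem sub_shift {d : ℕ} {γ : ℝ} {F : ℕ → ℝ} (hF : HasPhase (d + 1) γ F) (h : ℕ) :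
    HasPhase d (h * γ) (fun j => F (j + h) - F j) := by
  induction h with
  | zero => simpa using of_intCast (d := d) (F := fun _ => 0) fun _ => ⟨0, by simp⟩
  | succ h ih =>
    have hF' : HasPhase d γ (fun j => F (j + 1) - F j) := hF
    have h1 := (hF'.shift h).add ih
    convert h1 using 1
    · push_cast; ring
    · ext j
      rw [add_right_comm j h 1, ← add_assoc]; ring_nf

theorem of_fwdDiff {d : ℕ} {γ : ℝ} {G : ℝ → ℝ} (hG : ∀ x, (fwdDiff (1 : ℝ))^[d] G x = γ) :
    HasPhase d γ (fun j => G j) := by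
  induction d generalizing G with
  | zero => exact fun j => ⟨0, by simpa using hG j⟩
  | succ d ih =>
    have := ih (G := fwdDiff 1 G) (fun x => by rw [← hG x]; rfl)
    simpa [HasPhase, fwdDiff] using this

theorem of_polynomial {d : ℕ} {P : ℝ[X]} (hP : P.natDegree ≤ d) :
    HasPhase d (d.factorial * P.coeff d) (fun j => P.eval (j : ℝ)) := by
  refine of_fwdDiff (G := fun x => P.eval x) fun x => ?_
  rcases hP.lt_or_eq with h | h
  · rw [Polynomial.fwdDiff_iter_eq_zero_of_degree_lt h, Polynomial.coeff_eq_zero_of_natDegree_lt h]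
    simp
  · have := Polynomial.fwdDiff_iter_degree_eq_factorial P
    rw [h] at this
    rw [this, ← h]
    simp [mul_comm]

end HasPhase

/-! ### Diophantine approximation from frequent returns -/

/-- If `β h` is close to an integer for a positive proportion of the `h ≤ N`, then `β` is close to
a rational with small denominator. -/
theorem exists_small_denominator_of_frequent_return {β ε K : ℝ} {N : ℕ} (hN : 1 ≤ N) (hK : 1 ≤ K)
    (hε : ε ≤ 1 / (24 * K)) {H : Finset ℕ} (hH : ∀ h ∈ H, 1 ≤ h ∧ h ≤ N)
    (hcard : N / K ≤ H.card) (hret : ∀ h ∈ H, ∃ m : ℤ, |β * h - m| ≤ ε) :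
    ∃ (v : ℕ) (a : ℤ), 0 < v ∧ (v : ℝ) ≤ 8 * K ∧ |v * β - a| ≤ 8 * K ^ 2 * ε / N := by
  have hN0 : (0 : ℝ) < N := by exact_mod_cast hN
  have hK0 : (0 : ℝ) < K := by linarith
  have hHne : H.Nonempty := by
    rw [← Finset.card_pos]
    have : (0 : ℝ) < H.card := lt_of_lt_of_le (by positivity) hcard
    exact_mod_cast this
  have hε0 : 0 ≤ ε := by
    obtain ⟨h, hh⟩ := hHne
    obtain ⟨m, hm⟩ := hret h hh
    exact (abs_nonneg _).trans hm
  -- Dirichlet's theorem with bound 2N rather than N makes h|vβ - a| at most 1/2 for every h ≤ N.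
  obtain ⟨r, hr, hrden⟩ := Real.exists_rat_abs_sub_le_and_den_le β (n := 2 * N) (by omega)
  set v := r.den with hv
  set a := r.num with ha
  have hv0 : 0 < v := r.den_pos
  have hv0' : (0 : ℝ) < v := by exact_mod_cast hv0
  have hcop : IsCoprime (a : ℤ) (v : ℤ) := Rat.isCoprime_num_den r
  set η : ℝ := v * β - a with hη
  have hrv : (r : ℝ) = a / v := by rw [ha, hv]; exact_mod_cast (Rat.num_div_den r).symm
  have hηN : |η| * (2 * N) ≤ 1 := by
    have e : η = v * (β - r) := by rw [hη, hrv]; field_simp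
    rw [e, abs_mul, abs_of_pos hv0']
    have h2 : |β - r| * ((2 * N + 1) * v) ≤ 1 := by
      rw [← le_div_iff₀ (by positivity)]
      exact_mod_cast hr
    nlinarith [abs_nonneg (β - r), mul_nonneg (abs_nonneg (β - r)) hv0'.le]
  choose! m hm using hret
  -- the integers `a h - v (m h)` are small
  have hsmall : ∀ h ∈ H, |((a * h - v * m h : ℤ) : ℝ)| ≤ ε * v + 1 / 2 := by
    intro h hh
    have e : ((a * h - v * m h : ℤ) : ℝ) = v * (β * h - m h) - h * η := by
      rw [hη]; push_cast; ring
    rw [e]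
    refine (abs_sub _ _).trans ?_
    rw [abs_mul, abs_mul, abs_of_pos hv0', Nat.abs_cast]
    have h1 := hm h hh
    have h2 : (h : ℝ) ≤ N := by exact_mod_cast (hH h hh).2
    have h3 : (h : ℝ) * |η| ≤ N * |η| := mul_le_mul_of_nonneg_right h2 (abs_nonneg _)
    nlinarith
  have hvK : (v : ℝ) ≤ 8 * K := by
    set T : ℕ := ⌊ε * v + 1 / 2⌋₊ with hT
    have hT' : (T : ℝ) ≤ ε * v + 1 / 2 := Nat.floor_le (by positivity)
    -- The integer ah - v(m h) determines ah mod v, hence h mod v since a and v are coprime;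
    -- together with h / v it determines h. As few such integers are available, a large v would
    -- leave too few elements in `H`.
    have hinj : H.card ≤ ((Finset.range (N / v + 1)) ×ˢ (Finset.Icc (-(T : ℤ)) T)).card := by
      refine Finset.card_le_card_of_injOn (fun h => (h / v, a * h - v * m h)) ?_ ?_
      · intro h hh
        have hh' : h ∈ H := hh
        simp only [Finset.coe_product, Set.mem_prod, Finset.mem_coe, Finset.mem_range,
          Finset.mem_Icc, ← abs_le]
        refine ⟨Nat.lt_succ_of_le (Nat.div_le_div_right (hH h hh').2), ?_⟩
        have h1 := hsmall h hh'
        have h2 : |a * h - v * m h|.toNat ≤ T := by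
          rw [hT, Nat.le_floor_iff (by positivity)]
          refine le_trans (le_of_eq ?_) h1
          rw [← Int.cast_abs]
          exact_mod_cast Int.toNat_of_nonneg (abs_nonneg _)
        have := Int.toNat_of_nonneg (abs_nonneg (a * h - v * m h))
        omega
      · intro h hh h' hh' heq
        simp only [Prod.mk.injEq] at heq
        obtain ⟨e1, e2⟩ := heq
        have hdvd : (v : ℤ) ∣ (h : ℤ) - h' := by
          have : (v : ℤ) ∣ a * ((h : ℤ) - h') := ⟨m h - m h', by linarith⟩
          exact hcop.symm.dvd_of_dvd_mul_left this
        have hmod : h % v = h' % v := by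
          have := (Nat.modEq_iff_dvd.mpr hdvd : h' ≡ h [MOD v])
          exact this.symm
        rw [← Nat.div_add_mod h v, ← Nat.div_add_mod h' v, e1, hmod]
    rw [Finset.card_product, Finset.card_range, Int.card_Icc] at hinj
    have hinj' : (H.card : ℝ) ≤ (N / v + 1) * (2 * T + 1) := by
      have e : ((T : ℤ) + 1 - -(T : ℤ)).toNat = 2 * T + 1 := by omega
      rw [e] at hinj
      have : (H.card : ℝ) ≤ ((N / v : ℕ) + 1) * (2 * T + 1) := by exact_mod_cast hinj
      refine this.trans (mul_le_mul_of_nonneg_right ?_ (by positivity))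
      have := @Nat.cast_div_le ℝ _ _ _ N v
      linarith
    have hvN : (v : ℝ) ≤ 2 * N := by exact_mod_cast hrden
    have h1 : (N : ℝ) / v + 1 ≤ 3 * N / v := by
      rw [div_add_one hv0'.ne']
      exact div_le_div_of_nonneg_right (by linarith) hv0'.le
    have h2 : (N : ℝ) / K ≤ 3 * N / v * (2 * (ε * v + 1 / 2) + 1) :=
      hcard.trans (hinj'.trans (mul_le_mul h1 (by linarith) (by positivity) (by positivity)))
    have h3 : 3 * (N : ℝ) / v * (2 * (ε * v + 1 / 2) + 1) = N * (6 * ε + 6 / v) := by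
      field_simp; ring
    rw [h3, div_eq_mul_one_div] at h2
    have h4 : 1 / K ≤ 6 * ε + 6 / v := le_of_mul_le_mul_left h2 hN0
    have h5 : 6 * ε ≤ 1 / 4 * (1 / K) := by
      have : 1 / (24 * K) = 1 / 24 * (1 / K) := by field_simp
      rw [this] at hε
      linarith
    have h6 : 3 / 4 * (1 / K) ≤ 6 / v := by linarith
    rw [mul_one_div, div_le_div_iff₀ hK0 hv0'] at h6
    linarith
  have hεv : ε * v < 1 / 2 := by
    have : ε * v ≤ 1 / (24 * K) * (8 * K) := mul_le_mul hε hvK hv0'.le (by positivity)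
    have e : 1 / (24 * K) * (8 * K) = 1 / 3 := by field_simp; norm_num
    linarith
  refine ⟨v, a, hv0, hvK, ?_⟩
  -- Now that v ≤ 8K, the integers ah - v(m h) have modulus below 1 and vanish, so the error at h is
  -- exactly h(vβ - a)/v. The largest h in `H`, which is at least the cardinality of `H`, then gives
  -- the sharp bound.
  have hdiv : ∀ h ∈ H, |(h : ℝ)| * |η| ≤ ε * v := by
    intro h hh
    have h1 : |((a * h - v * m h : ℤ) : ℝ)| < 1 := lt_of_le_of_lt (hsmall h hh) (by linarith)
    have h2 : a * h - v * m h = 0 := by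
      rw [← Int.cast_abs] at h1
      exact Int.abs_lt_one_iff.mp (by exact_mod_cast h1)
    have h3 : (h : ℝ) * η = v * (β * h - m h) := by
      have : ((a * h - v * m h : ℤ) : ℝ) = 0 := by rw [h2]; simp
      push_cast at this
      rw [hη]; linarith
    rw [← abs_mul, h3, abs_mul, abs_of_pos hv0', mul_comm]
    exact mul_le_mul_of_nonneg_right (hm h hh) hv0'.le
  obtain ⟨h, hh, hbig⟩ : ∃ h ∈ H, (N : ℝ) / K ≤ h := by
    refine ⟨H.max' hHne, H.max'_mem hHne, hcard.trans ?_⟩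
    have hsub : H ⊆ Finset.Icc 1 (H.max' hHne) := fun h hh =>
      Finset.mem_Icc.mpr ⟨(hH h hh).1, H.le_max' h hh⟩
    have := Finset.card_le_card hsub
    rw [Nat.card_Icc] at this
    exact_mod_cast this.trans (by omega)
  have h1 := hdiv h hh
  rw [Nat.abs_cast] at h1
  have h2 : (N : ℝ) / K * |η| ≤ ε * (8 * K) :=
    (mul_le_mul_of_nonneg_right hbig (abs_nonneg _)).trans
      (h1.trans (mul_le_mul_of_nonneg_left hvK hε0))
  rw [le_div_iff₀ hN0]
  have h3 : (N : ℝ) / K * |η| * K = N * |η| := by field_simp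
  nlinarith [mul_le_mul_of_nonneg_right h2 hK0.le]

/-! ### Van der Corput differencing and Weyl's inequality -/

/-- Van der Corput's identity: the squared modulus of a sum of unimodular numbers in terms of
correlations. -/
theorem norm_sum_sq_eq_correlations {a : ℕ → ℂ} (ha : ∀ j, ‖a j‖ = 1) (L : ℕ) :
    ‖∑ j ∈ Finset.range L, a j‖ ^ 2 = L + 2 * (∑ h ∈ Finset.Icc 1 L,
      ∑ j ∈ Finset.range (L - h), a (j + h) * (starRingEnd ℂ) (a j)).re := by
  induction L with
  | zero => simp
  | succ L ih =>
    have h1 : ∑ h ∈ Finset.Icc 1 (L + 1),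
        ∑ j ∈ Finset.range (L + 1 - h), a (j + h) * (starRingEnd ℂ) (a j) =
        ∑ h ∈ Finset.Icc 1 L, ∑ j ∈ Finset.range (L - h), a (j + h) * (starRingEnd ℂ) (a j) +
        ∑ h ∈ Finset.Icc 1 L, a L * (starRingEnd ℂ) (a (L - h)) := by
      rw [Finset.sum_Icc_succ_top (by omega), Nat.sub_self, Finset.range_zero, Finset.sum_empty,
        add_zero, ← Finset.sum_add_distrib]
      refine Finset.sum_congr rfl fun h hh => ?_
      have hL := (Finset.mem_Icc.mp hh).2
      rw [show L + 1 - h = (L - h) + 1 by omega, Finset.sum_range_succ, Nat.sub_add_cancel hL]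
    have h2 : ∑ h ∈ Finset.Icc 1 L, a L * (starRingEnd ℂ) (a (L - h)) =
        a L * (starRingEnd ℂ) (∑ j ∈ Finset.range L, a j) := by
      rw [map_sum, Finset.mul_sum]
      refine Finset.sum_nbij' (fun h => L - h) (fun j => L - j) ?_ ?_ ?_ ?_ ?_
      · intro h hh; simp only [Finset.mem_Icc, Finset.mem_range] at *; omega
      · intro h hh; simp only [Finset.mem_Icc, Finset.mem_range] at *; omega
      · intro h hh; simp only [Finset.mem_Icc] at hh; omega
      · intro h hh; simp only [Finset.mem_range] at hh; omega
      · intro h hh; rfl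
    rw [h1, h2, Finset.sum_range_succ]
    set S := ∑ j ∈ Finset.range L, a j
    have h3 : ‖S + a L‖ ^ 2 = ‖S‖ ^ 2 + 1 + 2 * (a L * (starRingEnd ℂ) S).re := by
      have h5 : ‖a L‖ ^ 2 = 1 := by rw [ha]; norm_num
      rw [← Complex.normSq_eq_norm_sq] at h5 ⊢
      rw [← Complex.normSq_eq_norm_sq, Complex.normSq_add, h5, ← Complex.conj_re (S * _)]
      simp [mul_comm]
    rw [h3, ih, Complex.add_re]
    push_cast; ring

theorem norm_sum_sq_le_correlations {a : ℕ → ℂ} (ha : ∀ j, ‖a j‖ = 1) (L : ℕ) :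
    ‖∑ j ∈ Finset.range L, a j‖ ^ 2 ≤ L + 2 * ∑ h ∈ Finset.Icc 1 L,
      ‖∑ j ∈ Finset.range (L - h), a (j + h) * (starRingEnd ℂ) (a j)‖ := by
  rw [norm_sum_sq_eq_correlations ha]
  gcongr
  exact (Complex.re_le_norm _).trans (norm_sum_le _ _)

theorem norm_sum_unitExp_le (F : ℕ → ℝ) (L : ℕ) :
    ‖∑ j ∈ Finset.range L, unitExp (F j)‖ ≤ L := by
  refine (norm_sum_le _ _).trans ?_
  simp

/-- The trivial approximation with denominator 1, which disposes of every N bounded by a power of K.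
-/
theorem abs_mul_round_le_one_div {γ B : ℝ} {M : ℕ} {m : ℕ} (h : (M : ℝ) ^ m ≤ B) (hM : 1 ≤ M) :
    ∃ a : ℤ, |((1 : ℕ) : ℝ) * γ - a| ≤ B / (M : ℝ) ^ m := by
  have hM0 : (0 : ℝ) < (M : ℝ) ^ m := by positivity
  refine ⟨round γ, ?_⟩
  rw [Nat.cast_one, one_mul]
  have := abs_sub_round γ
  have h1 : 1 ≤ B / (M : ℝ) ^ m := by rwa [le_div_iff₀ hM0, one_mul]
  linarith

/-- A phase of degree 1 is F 0 + jγ mod 1, so the sum is geometric. This is the base case of Weyl's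
inequality. -/
theorem norm_sum_unitExp_hasPhase_one {γ : ℝ} {F : ℕ → ℝ} (hF : HasPhase 1 γ F) (L : ℕ) :
    |γ - round γ| * ‖∑ j ∈ Finset.range L, unitExp (F j)‖ ≤ 1 / 2 := by
  have h1 : ∀ j, unitExp (F j) = unitExp (F 0) * unitExp γ ^ j := by
    intro j
    induction j with
    | zero => simp
    | succ j ih =>
      obtain ⟨m, hm⟩ := hF j
      have : F (j + 1) = F j + γ + m := by linarith
      rw [this, unitExp_add_intCast, unitExp_add, ih, pow_succ, mul_assoc]
  rw [Finset.sum_congr rfl fun j _ => h1 j, ← Finset.mul_sum, norm_mul, norm_unitExp, one_mul]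
  exact abs_sub_round_mul_norm_sum_unitExp_le γ L

/-- A quantitative form of Weyl's inequality: a large exponential sum with polynomial phase of
degree `d + 1` forces the leading coefficient to be close to a rational with small denominator. -/
theorem exists_small_denominator_of_large_weyl_sum (d : ℕ) : ∃ C : ℕ, ∀ (γ : ℝ) (F : ℕ → ℝ),
    HasPhase (d + 1) γ F → ∀ (N L : ℕ) (K : ℝ), 1 ≤ N → L ≤ N → 2 ≤ K →
    N / K ≤ ‖∑ j ∈ Finset.range L, unitExp (F j)‖ →
    ∃ (v : ℕ) (a : ℤ), 0 < v ∧ (v : ℝ) ≤ K ^ C ∧ |v * γ - a| ≤ K ^ C / (N : ℝ) ^ (d + 1) := by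
  induction d with
  | zero =>
    refine ⟨1, fun γ F hF N L K hN hL hK hS => ⟨1, round γ, one_pos, ?_, ?_⟩⟩
    · simp; linarith
    · have hN0 : (0 : ℝ) < N := by exact_mod_cast hN
      have h1 := norm_sum_unitExp_hasPhase_one hF L
      have h2 := (mul_le_mul_of_nonneg_left hS (abs_nonneg (γ - round γ))).trans h1
      rw [Nat.cast_one, one_mul, zero_add, pow_one, pow_one, le_div_iff₀ hN0]
      have h3 : |γ - round γ| * (N / K) * K = |γ - round γ| * N := by field_simp
      nlinarith
  | succ d ih =>
    obtain ⟨C, hC⟩ := ih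
    refine ⟨20 * C + 20 + 3 * (d + 2), fun γ F hF N L K hN hL hK hS => ?_⟩
    -- The part 3(d + 2) serves the case N < 2K² ≤ K³, and 20C + 20 the case where the
    -- approximations for the individual shifts are too coarse. The main case needs only 15C + 13.
    set D := 20 * C + 20 + 3 * (d + 2) with hD
    have hN0 : (0 : ℝ) < N := by exact_mod_cast hN
    have hN1 : (1 : ℝ) ≤ N := by exact_mod_cast hN
    have hK1 : (1 : ℝ) ≤ K := by linarith
    have hK0 : (0 : ℝ) < K := by linarith
    have hmono : ∀ {i j : ℕ}, i ≤ j → K ^ i ≤ K ^ j := fun h => pow_le_pow_right₀ hK1 h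
    have h2K : ∀ i : ℕ, (2 : ℝ) ^ i ≤ K ^ i := fun i => pow_le_pow_left₀ (by norm_num) hK i
    have htriv : (N : ℝ) ^ (d + 1 + 1) ≤ K ^ D → ∃ (v : ℕ) (a : ℤ), 0 < v ∧ (v : ℝ) ≤ K ^ D ∧
        |v * γ - a| ≤ K ^ D / (N : ℝ) ^ (d + 1 + 1) := by
      intro h
      obtain ⟨a, ha⟩ := abs_mul_round_le_one_div (γ := γ) h hN
      exact ⟨1, a, one_pos, by rw [Nat.cast_one]; exact one_le_pow₀ hK1, ha⟩
    rcases lt_or_ge (N : ℝ) (2 * K ^ 2) with hsmall | hlarge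
    · refine htriv ?_
      have h1 : (N : ℝ) ≤ K ^ 3 := by nlinarith [sq_nonneg K]
      calc (N : ℝ) ^ (d + 1 + 1) ≤ (K ^ 3) ^ (d + 1 + 1) := pow_le_pow_left₀ hN0.le h1 _
        _ = K ^ (3 * (d + 2)) := by rw [← pow_mul]
        _ ≤ K ^ D := hmono (by omega)
    set t : ℕ → ℝ := fun h => ‖∑ j ∈ Finset.range (L - h), unitExp (F (j + h) - F j)‖ with ht
    have hcor : (N / K : ℝ) ^ 2 ≤ N + 2 * ∑ h ∈ Finset.Icc 1 N, t h := by
      have h1 := norm_sum_sq_le_correlations (a := fun j => unitExp (F j))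
        (fun j => norm_unitExp _) L
      simp_rw [← unitExp_sub] at h1
      have h2 : ∑ h ∈ Finset.Icc 1 L, t h ≤ ∑ h ∈ Finset.Icc 1 N, t h :=
        Finset.sum_le_sum_of_subset_of_nonneg (Finset.Icc_subset_Icc le_rfl hL)
          fun _ _ _ => norm_nonneg _
      have h3 : (L : ℝ) ≤ N := by exact_mod_cast hL
      have h4 := pow_le_pow_left₀ (by positivity) hS 2
      linarith
    -- The correlations sum to at least N²/(4K²). Those below N/(8K²) account for at most half of
    -- this, so at least N/(8K²) shifts exceed that threshold. Since K ≥ 2, K⁵ ≥ 8K², and both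
    -- bounds can be written with pure powers of K.
    set H : Finset ℕ := (Finset.Icc 1 N).filter fun h => (N : ℝ) / K ^ 5 ≤ t h with hH
    have hHcard : (N : ℝ) / K ^ 5 ≤ H.card := by
      have h1 : ∑ h ∈ Finset.Icc 1 N, t h ≤ H.card * N + N * (N / K ^ 5) := by
        rw [← Finset.sum_filter_add_sum_filter_not _ (fun h => (N : ℝ) / K ^ 5 ≤ t h)]
        refine add_le_add ?_ ?_
        · rw [← nsmul_eq_mul]
          refine Finset.sum_le_card_nsmul _ _ _ fun h _ => ?_
          refine (norm_sum_unitExp_le _ _).trans ?_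
          exact_mod_cast (Nat.sub_le _ _).trans hL
        · refine (Finset.sum_le_card_nsmul _ _ ((N : ℝ) / K ^ 5) fun h hh => ?_).trans ?_
          · exact (not_le.mp (Finset.mem_filter.mp hh).2).le
          · rw [nsmul_eq_mul]
            refine mul_le_mul_of_nonneg_right ?_ (by positivity)
            exact_mod_cast (Finset.card_filter_le _ _).trans (by simp)
      have h2 : (N : ℝ) ≤ N ^ 2 / (2 * K ^ 2) := by
        rw [le_div_iff₀ (by positivity)]; nlinarith
      have h3 : (N : ℝ) / K ^ 5 ≤ N / (8 * K ^ 2) := by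
        refine div_le_div_of_nonneg_left hN0.le (by positivity) ?_
        have := h2K 3
        nlinarith [sq_nonneg K, mul_le_mul_of_nonneg_right this (sq_nonneg K)]
      have h4 : (N : ℝ) ^ 2 / (4 * K ^ 2) ≤ H.card * N + N * (N / (8 * K ^ 2)) := by
        have e : (N / K : ℝ) ^ 2 = 2 * (N ^ 2 / (4 * K ^ 2)) + N ^ 2 / (2 * K ^ 2) := by
          field_simp; ring
        have h5 := mul_le_mul_of_nonneg_left h3 hN0.le
        rw [e] at hcor
        linarith
      have e : (N : ℝ) ^ 2 / (4 * K ^ 2) = N / (8 * K ^ 2) * N + N * (N / (8 * K ^ 2)) := by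
        field_simp; ring
      rw [e] at h4
      have h6 : (N : ℝ) / (8 * K ^ 2) ≤ H.card := le_of_mul_le_mul_right (by linarith) hN0
      linarith
    have hHmem : ∀ h ∈ H, 1 ≤ h ∧ h ≤ N := fun h hh =>
      Finset.mem_Icc.mp (Finset.mem_filter.mp hh).1
    have happ : ∀ h ∈ H, ∃ (v : ℕ) (a : ℤ), 0 < v ∧ (v : ℝ) ≤ K ^ (5 * C) ∧
        |v * (h * γ) - a| ≤ K ^ (5 * C) / (N : ℝ) ^ (d + 1) := by
      intro h hh
      have h1 := hC _ _ (hF.sub_shift h) N (L - h) (K ^ 5) hN ((Nat.sub_le _ _).trans hL)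
        ((by norm_num : (2 : ℝ) ≤ 2 ^ 5).trans (h2K 5)) (Finset.mem_filter.mp hh).2
      rwa [← pow_mul] at h1
    choose! v a hv0 hv hva using happ
    set R : ℕ := ⌊K ^ (5 * C)⌋₊ with hR
    have hR1 : 1 ≤ R := by
      rw [hR, Nat.le_floor_iff (by positivity), Nat.cast_one]; exact one_le_pow₀ hK1
    have hRle : (R : ℝ) ≤ K ^ (5 * C) := Nat.floor_le (by positivity)
    -- The denominators depend on h but take at most K^(5C) values. By pigeonhole one value v₀
    -- serves a proportion K^(-5C-5) of all shifts, so the multiples h·v₀γ return near the integers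
    -- often.
    obtain ⟨v₀, hv₀, hfib⟩ := Finset.exists_le_card_fiber_of_nsmul_le_card_of_maps_to
      (s := H) (t := Finset.Icc 1 R) (f := v) (b := (N : ℝ) / K ^ (5 * C + 5))
      (fun h hh => Finset.mem_Icc.mpr ⟨hv0 h hh, by
        rw [hR, Nat.le_floor_iff (by positivity)]; exact hv h hh⟩)
      ⟨1, Finset.mem_Icc.mpr ⟨le_rfl, hR1⟩⟩ (by
        rw [Nat.card_Icc, Nat.add_sub_cancel, nsmul_eq_mul]
        refine le_trans ?_ hHcard
        rw [pow_add, ← div_div, mul_div_assoc']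
        refine div_le_div_of_nonneg_right ?_ (by positivity)
        rw [mul_div_assoc', div_le_iff₀ (by positivity), mul_comm]
        exact mul_le_mul_of_nonneg_left hRle hN0.le)
    have hv₀0 : 0 < v₀ := (Finset.mem_Icc.mp hv₀).1
    have hv₀K : (v₀ : ℝ) ≤ K ^ (5 * C) := by
      refine le_trans ?_ hRle
      exact_mod_cast (Finset.mem_Icc.mp hv₀).2
    have hNd : (0 : ℝ) < (N : ℝ) ^ (d + 1) := by positivity
    -- If the error is too large for the return lemma, then N^(d+1) is itself bounded by a power of
    -- K and the trivial approximation is enough.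
    rcases le_or_gt (K ^ (5 * C) / (N : ℝ) ^ (d + 1)) (1 / (24 * K ^ (5 * C + 5))) with hε | hε
    · obtain ⟨w, b, hw0, hw, hwb⟩ := exists_small_denominator_of_frequent_return
        (β := v₀ * γ) (K := K ^ (5 * C + 5)) hN (one_le_pow₀ hK1) hε
        (H := H.filter fun h => v h = v₀) (fun h hh => hHmem h (Finset.mem_filter.mp hh).1) hfib
        (fun h hh => ⟨a h, by
          obtain ⟨h1, h2⟩ := Finset.mem_filter.mp hh
          have := hva h h1
          rw [h2] at this
          rwa [mul_assoc, mul_comm γ]⟩)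
      refine ⟨w * v₀, b, Nat.mul_pos hw0 hv₀0, ?_, ?_⟩
      · have h8 := h2K 3
        norm_num at h8
        calc ((w * v₀ : ℕ) : ℝ) = w * v₀ := by push_cast; ring
          _ ≤ (8 * K ^ (5 * C + 5)) * K ^ (5 * C) :=
            mul_le_mul hw hv₀K (by positivity) (by positivity)
          _ ≤ (K ^ 3 * K ^ (5 * C + 5)) * K ^ (5 * C) := by gcongr
          _ = K ^ (3 + (5 * C + 5) + 5 * C) := by ring
          _ ≤ K ^ D := hmono (by omega)
      · have h8 := h2K 3
        norm_num at h8
        have e : ((w * v₀ : ℕ) : ℝ) * γ - b = w * (v₀ * γ) - b := by push_cast; ring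
        rw [e]
        refine hwb.trans ?_
        rw [mul_div_assoc', div_div, ← pow_succ]
        refine div_le_div_of_nonneg_right ?_ (by positivity)
        calc 8 * (K ^ (5 * C + 5)) ^ 2 * K ^ (5 * C)
            ≤ K ^ 3 * (K ^ (5 * C + 5)) ^ 2 * K ^ (5 * C) := by gcongr
          _ = K ^ (3 + (5 * C + 5) * 2 + 5 * C) := by ring
          _ ≤ K ^ D := hmono (by omega)
    · refine htriv ?_
      have h24 := h2K 5
      norm_num at h24
      rw [div_lt_div_iff₀ (by positivity) hNd, one_mul] at hε
      have h1 : (N : ℝ) ^ (d + 1) ≤ K ^ (10 * C + 10) := by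
        calc (N : ℝ) ^ (d + 1) ≤ K ^ (5 * C) * (24 * K ^ (5 * C + 5)) := hε.le
          _ ≤ K ^ (5 * C) * (K ^ 5 * K ^ (5 * C + 5)) := by gcongr; linarith
          _ = K ^ (5 * C + (5 + (5 * C + 5))) := by ring
          _ = K ^ (10 * C + 10) := by congr 1; ring
      calc (N : ℝ) ^ (d + 1 + 1) ≤ (N : ℝ) ^ ((d + 1) * 2) := pow_le_pow_right₀ hN1 (by omega)
        _ = ((N : ℝ) ^ (d + 1)) ^ 2 := pow_mul _ _ _
        _ ≤ (K ^ (10 * C + 10)) ^ 2 := pow_le_pow_left₀ hNd.le h1 2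
        _ = K ^ (20 * C + 20) := by rw [← pow_mul]; congr 1; ring
        _ ≤ K ^ D := hmono (by omega)

/-! ### Summation by parts along residue classes -/

/-- Abel's inequality. -/
theorem norm_sum_antitone_mul_le {w : ℕ → ℝ} {a : ℕ → ℂ} {N : ℕ} {B : ℝ}
    (hw : ∀ l, 0 ≤ w l) (hanti : Antitone w)
    (hB : ∀ L ≤ N, ‖∑ l ∈ Finset.range L, a l‖ ≤ B) :
    ‖∑ l ∈ Finset.range N, (w l : ℂ) * a l‖ ≤ w 0 * B := by
  set S : ℕ → ℂ := fun L => ∑ l ∈ Finset.range L, a l with hS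
  have hB0 : 0 ≤ B := (norm_nonneg _).trans (hB 0 (Nat.zero_le _))
  have key : ∀ M, ∑ l ∈ Finset.range M, (w l : ℂ) * a l =
      (w M : ℂ) * S M + ∑ l ∈ Finset.range M, ((w l - w (l + 1) : ℝ) : ℂ) * S (l + 1) := by
    intro M
    induction M with
    | zero => simp [hS]
    | succ M ih =>
      have e : S (M + 1) = S M + a M := Finset.sum_range_succ _ _
      rw [Finset.sum_range_succ, ih, Finset.sum_range_succ, e]
      push_cast; ring
  rw [key]
  have h1 : ‖(w N : ℂ) * S N‖ ≤ w N * B := by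
    rw [norm_mul, Complex.norm_real, Real.norm_of_nonneg (hw N)]
    exact mul_le_mul_of_nonneg_left (hB N le_rfl) (hw N)
  have h2 : ‖∑ l ∈ Finset.range N, ((w l - w (l + 1) : ℝ) : ℂ) * S (l + 1)‖ ≤
      (w 0 - w N) * B := by
    rw [← Finset.sum_range_sub' w N, Finset.sum_mul]
    refine norm_sum_le_of_le _ fun l hl => ?_
    have h3 : 0 ≤ w l - w (l + 1) := sub_nonneg.mpr (hanti (Nat.le_succ l))
    rw [norm_mul, Complex.norm_real, Real.norm_of_nonneg h3]
    exact mul_le_mul_of_nonneg_left (hB _ (Finset.mem_range.mp hl)) h3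
  refine (norm_add_le _ _).trans ?_
  linarith

theorem sum_range_mul_eq (f : ℕ → ℂ) (q M : ℕ) :
    ∑ j ∈ Finset.range (q * M), f j =
      ∑ r ∈ Finset.range q, ∑ l ∈ Finset.range M, f (q * l + r) := by
  rw [Finset.sum_comm]
  induction M with
  | zero => simp
  | succ M ih => rw [Nat.mul_succ, Finset.sum_range_add, ih, Finset.sum_range_succ]

/-- Abel summation in each residue class mod q: the weight 1/j starts at no more than 1/(qN), and
the q classes together give B/N. -/
theorem norm_sum_div_le_of_residues {a : ℕ → ℂ} {q N : ℕ} {B : ℝ} (hq : 0 < q) (hN : 0 < N)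
    (h : ∀ r < q, ∀ L ≤ N, ‖∑ l ∈ Finset.range L, a (q * (N + l) + r)‖ ≤ B) :
    ‖∑ j ∈ Finset.Ico (q * N) (q * (2 * N)), a j / j‖ ≤ B / N := by
  have hB0 : 0 ≤ B := (norm_nonneg _).trans (h 0 hq 0 (Nat.zero_le _))
  have hqN : 0 < q * N := Nat.mul_pos hq hN
  rw [Finset.sum_Ico_eq_sum_range, show q * (2 * N) - q * N = q * N by
    rw [two_mul, mul_add, Nat.add_sub_cancel], sum_range_mul_eq]
  have h1 : ∀ r ∈ Finset.range q, ‖∑ l ∈ Finset.range N,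
      a (q * N + (q * l + r)) / ((q * N + (q * l + r) : ℕ) : ℂ)‖ ≤ 1 / (q * N : ℝ) * B := by
    intro r hr
    have h2 := norm_sum_antitone_mul_le (w := fun l => 1 / ((q * N + (q * l + r) : ℕ) : ℝ))
      (a := fun l => a (q * N + (q * l + r))) (N := N) (B := B) (fun l => by positivity)
      (fun l l' hl => by
        refine one_div_le_one_div_of_le (by positivity) ?_
        have := Nat.mul_le_mul_left q hl
        exact_mod_cast (by omega : q * N + (q * l + r) ≤ q * N + (q * l' + r)))
      (fun L hL => by
        have := h r (Finset.mem_range.mp hr) L hL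
        simpa only [mul_add, add_assoc] using this)
    refine le_trans (le_of_eq ?_) (h2.trans ?_)
    · congr 1
      refine Finset.sum_congr rfl fun l _ => ?_
      push_cast
      rw [div_eq_mul_one_div, mul_comm]
    · refine mul_le_mul_of_nonneg_right ?_ hB0
      refine one_div_le_one_div_of_le (by positivity) ?_
      push_cast
      have : (0 : ℝ) ≤ q * (0 : ℕ) + r := by positivity
      linarith
  refine (norm_sum_le_of_le _ h1).trans (le_of_eq ?_)
  rw [Finset.sum_const, Finset.card_range, nsmul_eq_mul]
  have : (q : ℝ) ≠ 0 := by positivity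
  have : (N : ℝ) ≠ 0 := by positivity
  field_simp

/-! ### Symmetric sums with weight 1/j -/

/-- The symmetric sum of `u j / j` over `X₁ ≤ |j| < X₂`. -/
noncomputable def symmSum (u : ℤ → ℂ) (X₁ X₂ : ℕ) : ℂ :=
  ∑ j ∈ Finset.Ico X₁ X₂, (u j - u (-j)) / (j : ℂ)

theorem symmSum_add_symmSum (u : ℤ → ℂ) {X₁ X₂ X₃ : ℕ} (h₁ : X₁ ≤ X₂) (h₂ : X₂ ≤ X₃) :
    symmSum u X₁ X₂ + symmSum u X₂ X₃ = symmSum u X₁ X₃ :=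
  Finset.sum_Ico_consecutive _ h₁ h₂

theorem norm_sum_Ico_unitExp_div_le (y : ℝ) {X₁ X₂ : ℕ} (hX : 0 < X₁) :
    ‖∑ j ∈ Finset.Ico X₁ X₂, unitExp (j * y) / (j : ℂ)‖ * (X₁ * |y - round y|) ≤ 1 / 2 := by
  have hX' : (0 : ℝ) < X₁ := by exact_mod_cast hX
  set δ := |y - round y| with hδ
  rcases eq_or_lt_of_le (abs_nonneg (y - round y)) with h0 | h0
  · rw [hδ, ← h0]; norm_num
  rw [Finset.sum_Ico_eq_sum_range]
  have h1 := norm_sum_antitone_mul_le (w := fun l => 1 / ((X₁ + l : ℕ) : ℝ))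
    (a := fun l => unitExp ((X₁ + l : ℕ) * y)) (N := X₂ - X₁) (B := 1 / 2 / δ)
    (fun l => by positivity)
    (fun l l' hl => by
      refine one_div_le_one_div_of_le (by positivity) ?_
      exact_mod_cast Nat.add_le_add_left hl X₁)
    (fun L _ => by
      have e : ∀ l : ℕ, unitExp ((X₁ + l : ℕ) * y) = unitExp (X₁ * y) * unitExp y ^ l := by
        intro l
        rw [← unitExp_nat_mul, ← unitExp_add]; congr 1; push_cast; ring
      simp_rw [e, ← Finset.mul_sum, norm_mul, norm_unitExp, one_mul]
      rw [le_div_iff₀ h0, mul_comm]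
      exact abs_sub_round_mul_norm_sum_unitExp_le y L)
  have h2 : ‖∑ l ∈ Finset.range (X₂ - X₁), unitExp ((X₁ + l : ℕ) * y) / ((X₁ + l : ℕ) : ℂ)‖ ≤
      1 / (X₁ : ℝ) * (1 / 2 / δ) := by
    refine le_trans (le_of_eq ?_) (h1.trans (le_of_eq (by simp)))
    congr 1
    refine Finset.sum_congr rfl fun l _ => ?_
    push_cast
    rw [div_eq_mul_one_div, mul_comm]
  refine (mul_le_mul_of_nonneg_right h2 (by positivity)).trans (le_of_eq ?_)
  have : δ ≠ 0 := h0.ne'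
  field_simp

/-- The negative frequencies contribute the complex conjugate of the positive ones, so the one-sided
bound doubles. -/
theorem norm_symmSum_unitExp_mul_le (y : ℝ) {X₁ X₂ : ℕ} (hX : 0 < X₁) :
    ‖symmSum (fun j => unitExp (j * y)) X₁ X₂‖ * (X₁ * |y - round y|) ≤ 1 := by
  have e : symmSum (fun j => unitExp (j * y)) X₁ X₂ =
      ∑ j ∈ Finset.Ico X₁ X₂, unitExp (j * y) / (j : ℂ) -
      (starRingEnd ℂ) (∑ j ∈ Finset.Ico X₁ X₂, unitExp (j * y) / (j : ℂ)) := by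
    rw [symmSum, map_sum, ← Finset.sum_sub_distrib]
    refine Finset.sum_congr rfl fun j _ => ?_
    rw [map_div₀, conj_unitExp, Complex.conj_natCast, sub_div]
    push_cast
    rw [neg_mul]
  have h := norm_sum_Ico_unitExp_div_le y (X₂ := X₂) hX
  have h2 : ‖symmSum (fun j => unitExp (j * y)) X₁ X₂‖ ≤
      2 * ‖∑ j ∈ Finset.Ico X₁ X₂, unitExp (j * y) / (j : ℂ)‖ := by
    rw [e]
    refine (norm_sub_le _ _).trans (le_of_eq ?_)
    rw [RCLike.norm_conj]; ring
  have h3 : (0 : ℝ) ≤ X₁ * |y - round y| := by positivity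
  nlinarith

/-- Pairing j with -j is essential: the terms are 2i sin(2πjy)/j, whose sums stay bounded, whereas
one-sided sums grow logarithmically near integer y. Below 1/|t| each term is at most 4π|t|, for a
total below 13; beyond it the geometric sum bound gives 1. -/
theorem norm_symmSum_unitExp_le (y : ℝ) {X₁ X₂ : ℕ} (hX : 0 < X₁) :
    ‖symmSum (fun j => unitExp (j * y)) X₁ X₂‖ ≤ 14 := by
  -- reduce to `|y| ≤ 1/2`
  have hper : symmSum (fun j => unitExp (j * y)) X₁ X₂ =
      symmSum (fun j => unitExp (j * (y - round y))) X₁ X₂ := by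
    have : ∀ j : ℤ, unitExp (j * y) = unitExp (j * (y - round y)) := by
      intro j
      rw [← unitExp_add_intCast (j * (y - round y)) (j * round y)]
      congr 1; push_cast; ring
    simp only [symmSum, this]
  rw [hper]
  have hr : round (y - round y) = 0 := by simp
  set t := y - round y
  have hfar : ∀ {Y₁ : ℕ}, 0 < Y₁ → ∀ Y₂, 1 ≤ Y₁ * |t| →
      ‖symmSum (fun j => unitExp (j * t)) Y₁ Y₂‖ ≤ 1 := by
    intro Y₁ hY Y₂ h1
    have h2 := norm_symmSum_unitExp_mul_le t (X₂ := Y₂) hY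
    rw [hr, Int.cast_zero, sub_zero] at h2
    nlinarith [norm_nonneg (symmSum (fun j => unitExp (j * t)) Y₁ Y₂)]
  have hnear : ∀ Y₁ Y₂ : ℕ, 0 < Y₁ → ((Y₂ - Y₁ : ℕ) : ℝ) * |t| ≤ 1 →
      ‖symmSum (fun j => unitExp (j * t)) Y₁ Y₂‖ ≤ 13 := by
    intro Y₁ Y₂ hY h1
    have h2 : ∀ j ∈ Finset.Ico Y₁ Y₂, ‖(unitExp (((j : ℕ) : ℤ) * t) -
        unitExp ((-((j : ℕ) : ℤ) : ℤ) * t)) / ((j : ℕ) : ℂ)‖ ≤ 4 * Real.pi * |t| := by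
      intro j hj
      have hj0 : (0 : ℝ) < j := by
        exact_mod_cast lt_of_lt_of_le hY (Finset.mem_Ico.mp hj).1
      rw [norm_div, Complex.norm_natCast, div_le_iff₀ hj0]
      refine (norm_unitExp_sub_le _ _).trans (le_of_eq ?_)
      have e : (((j : ℕ) : ℤ) : ℝ) * t - ((-((j : ℕ) : ℤ) : ℤ) : ℝ) * t = 2 * j * t := by
        push_cast; ring
      rw [e, abs_mul, abs_of_pos (by positivity : (0 : ℝ) < 2 * j)]; ring
    refine (norm_sum_le_of_le _ h2).trans ?_
    rw [Finset.sum_const, Nat.card_Ico, nsmul_eq_mul]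
    have := Real.pi_lt_d2
    nlinarith [Real.pi_pos]
  rcases eq_or_ne t 0 with h0 | h0
  · exact (hnear X₁ X₂ hX (by rw [h0]; simp)).trans (by norm_num)
  have ht : 0 < |t| := abs_pos.mpr h0
  set m := ⌊1 / |t|⌋₊ with hm
  have hm1 : (m : ℝ) * |t| ≤ 1 := by
    rw [← le_div_iff₀ ht]; exact Nat.floor_le (by positivity)
  have hm2 : 1 ≤ ((m + 1 : ℕ) : ℝ) * |t| := by
    rw [← div_le_iff₀ ht]; push_cast; exact (Nat.lt_floor_add_one _).le
  rcases le_total X₂ (m + 1) with h | h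
  · refine (hnear X₁ X₂ hX (le_trans ?_ hm1)).trans (by norm_num)
    refine mul_le_mul_of_nonneg_right ?_ ht.le
    exact_mod_cast (by omega : X₂ - X₁ ≤ m)
  rcases le_total X₁ (m + 1) with h' | h'
  · rw [← symmSum_add_symmSum _ h' h]
    refine (norm_add_le _ _).trans ?_
    have h3 := hnear X₁ (m + 1) hX (le_trans (mul_le_mul_of_nonneg_right (by
      exact_mod_cast (by omega : m + 1 - X₁ ≤ m)) ht.le) hm1)
    have h4 := hfar (Nat.succ_pos m) X₂ hm2
    linarith
  · refine (hfar hX X₂ (hm2.trans (mul_le_mul_of_nonneg_right ?_ ht.le))).trans (by norm_num)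
    exact_mod_cast h'

/-! ### Periodic multipliers and discrete Fourier coefficients -/

/-- The discrete Fourier coefficients of a function on `ℤ` of period `V`. -/
noncomputable def periodicCoeff (g : ℤ → ℂ) (V : ℕ) (l : ℕ) : ℂ :=
  (∑ r ∈ Finset.range V, g r * unitExp (-(r * (l / V : ℝ)))) / V

theorem sum_range_unitExp_div (V : ℕ) (m : ℤ) (hV : 0 < V) :
    ∑ l ∈ Finset.range V, unitExp (m * (l / V : ℝ)) = if (V : ℤ) ∣ m then (V : ℂ) else 0 := by
  have hV0 : (V : ℝ) ≠ 0 := by positivity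
  have e : ∀ l : ℕ, unitExp (m * (l / V : ℝ)) = unitExp (m / V) ^ l := by
    intro l
    rw [← unitExp_nat_mul]; congr 1; ring
  simp_rw [e]
  split_ifs with h
  · obtain ⟨k, rfl⟩ := h
    have : (((V : ℤ) * k : ℤ) : ℝ) / V = k := by push_cast; field_simp
    rw [this, unitExp_intCast]
    simp
  · have h1 : unitExp (m / V) ≠ 1 := by
      intro h1
      have h2 := four_mul_abs_sub_round_le ((m : ℝ) / V)
      rw [h1, sub_self, norm_zero] at h2
      have h3 : (m : ℝ) / V = round ((m : ℝ) / V) := by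
        have := abs_nonpos_iff.mp (by linarith : |(m : ℝ) / V - round ((m : ℝ) / V)| ≤ 0)
        linarith
      refine h ⟨round ((m : ℝ) / V), ?_⟩
      rw [div_eq_iff hV0] at h3
      have : (m : ℝ) = ((V * round ((m : ℝ) / V) : ℤ) : ℝ) := by push_cast; rw [mul_comm]; exact h3
      exact_mod_cast this
    have h2 : unitExp (m / V) ^ V = 1 := by
      rw [← unitExp_nat_mul, mul_div_cancel₀ _ hV0, unitExp_intCast]
    rw [geom_sum_eq h1, h2, sub_self, zero_div]

theorem eq_sum_periodicCoeff {g : ℤ → ℂ} {V : ℕ} (hV : 0 < V) (hg : ∀ j, g (j + V) = g j)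
    (j : ℤ) : g j = ∑ l ∈ Finset.range V, periodicCoeff g V l * unitExp (j * (l / V : ℝ)) := by
  have hVC : (V : ℂ) ≠ 0 := by exact_mod_cast hV.ne'
  have hper : Function.Periodic g (V : ℤ) := hg
  have h1 : ∀ l ∈ Finset.range V, periodicCoeff g V l * unitExp (j * (l / V : ℝ)) =
      ∑ r ∈ Finset.range V, g r / V * unitExp ((j - r : ℤ) * (l / V : ℝ)) := by
    intro l _
    rw [periodicCoeff, Finset.sum_div, Finset.sum_mul]
    refine Finset.sum_congr rfl fun r _ => ?_
    have : unitExp ((j - r : ℤ) * (l / V : ℝ)) =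
        unitExp (-(r * (l / V : ℝ))) * unitExp (j * (l / V : ℝ)) := by
      rw [← unitExp_add]; congr 1; push_cast; ring
    rw [this]; ring
  rw [Finset.sum_congr rfl h1, Finset.sum_comm]
  simp_rw [← Finset.mul_sum, sum_range_unitExp_div V _ hV]
  set r₀ : ℕ := (j % V).toNat with hr₀
  have hVz : (V : ℤ) ≠ 0 := by exact_mod_cast hV.ne'
  have hr₀' : (r₀ : ℤ) = j % V := Int.toNat_of_nonneg (Int.emod_nonneg _ hVz)
  have hlt : r₀ < V := by
    have := Int.emod_lt_of_pos j (by exact_mod_cast hV : (0 : ℤ) < V)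
    omega
  rw [Finset.sum_eq_single r₀]
  · rw [if_pos, div_mul_cancel₀ _ hVC, hr₀']
    · have : j = j % V + (j / V) • (V : ℤ) := by
        rw [smul_eq_mul, mul_comm]; exact (Int.emod_add_mul_ediv j V).symm
      conv_lhs => rw [this]
      exact hper.zsmul _ _
    · rw [hr₀']; exact Int.dvd_self_sub_emod
  · intro r hr hne
    rw [if_neg, mul_zero]
    intro hd
    refine hne ?_
    have h2 : j % V = (r : ℤ) % V :=
      Int.emod_eq_emod_iff_emod_sub_eq_zero.mpr (Int.emod_eq_zero_of_dvd hd)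
    have h3 : (r : ℤ) % V = r := Int.emod_eq_of_lt (by positivity)
      (by exact_mod_cast Finset.mem_range.mp hr)
    omega
  · intro h; exact absurd (Finset.mem_range.mpr hlt) h

theorem norm_periodicCoeff_le_one {g : ℤ → ℂ} (hg : ∀ j, ‖g j‖ ≤ 1) (V l : ℕ) :
    ‖periodicCoeff g V l‖ ≤ 1 := by
  rw [periodicCoeff, norm_div, Complex.norm_natCast]
  refine div_le_one_of_le₀ ?_ (Nat.cast_nonneg V)
  refine (norm_sum_le_of_le _ (fun r _ => ?_ : ∀ r ∈ _, _ ≤ (1 : ℝ))).trans (by simp)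
  rw [norm_mul, norm_unitExp, mul_one]
  exact hg r

/-- Expanding g in characters mod V turns the sum into V sums of a single character, with
frequencies x + l/V. At most one frequency lies within less than 1/(2V) of an integer, and it costs
14η. Each other one costs at most 2V/X₁. -/
theorem norm_symmSum_periodic_le {g : ℤ → ℂ} {V : ℕ} {η : ℝ} (hV : 0 < V)
    (hper : ∀ j, g (j + V) = g j) (hg : ∀ j, ‖g j‖ ≤ 1)
    (hη : ∀ l < V, ‖periodicCoeff g V l‖ ≤ η) (x : ℝ) {X₁ X₂ : ℕ} (hX : 0 < X₁) :
    ‖symmSum (fun j => g j * unitExp (j * x)) X₁ X₂‖ ≤ 14 * η + 2 * V ^ 2 / X₁ := by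
  have hV0 : (0 : ℝ) < V := by exact_mod_cast hV
  have hX0 : (0 : ℝ) < X₁ := by exact_mod_cast hX
  have hη0 : 0 ≤ η := (norm_nonneg _).trans (hη 0 hV)
  have e1 : symmSum (fun j => g j * unitExp (j * x)) X₁ X₂ = ∑ l ∈ Finset.range V,
      periodicCoeff g V l * symmSum (fun j => unitExp (j * (x + l / V))) X₁ X₂ := by
    simp only [symmSum, Finset.mul_sum]
    rw [Finset.sum_comm]
    refine Finset.sum_congr rfl fun j _ => ?_
    have e2 : ∀ k : ℤ, g k * unitExp (k * x) = ∑ l ∈ Finset.range V,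
        periodicCoeff g V l * unitExp (k * (x + l / V)) := by
      intro k
      rw [eq_sum_periodicCoeff hV hper k, Finset.sum_mul]
      refine Finset.sum_congr rfl fun l _ => ?_
      rw [mul_assoc, ← unitExp_add]; congr 2; ring
    rw [e2, e2, ← Finset.sum_sub_distrib, Finset.sum_div]
    refine Finset.sum_congr rfl fun l _ => ?_
    ring
  -- l₀ is the residue of the integer nearest to -Vx, the only l for which x + l/V can be that close
  -- to an integer.
  set m : ℤ := round (-(V * x)) with hm
  set l₀ : ℕ := (m % V).toNat with hl₀
  have hVz : (V : ℤ) ≠ 0 := by exact_mod_cast hV.ne'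
  have hl₀' : (l₀ : ℤ) = m % V := Int.toNat_of_nonneg (Int.emod_nonneg _ hVz)
  have hfar : ∀ l < V, l ≠ l₀ →
      1 / (2 * V : ℝ) ≤ |(x + l / V) - round (x + l / V)| := by
    intro l hl hne
    set k := round (x + (l : ℝ) / V)
    have hne0 : (l : ℤ) - m - V * k ≠ 0 := by
      intro h0
      refine hne ?_
      have h1 : m % V = (l : ℤ) % V := by
        have : m = l + V * (-k) := by linarith
        rw [this, Int.add_mul_emod_self_left]
      have h2 : (l : ℤ) % V = l := Int.emod_eq_of_lt (by positivity) (by exact_mod_cast hl)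
      omega
    have h1 : (1 : ℝ) ≤ |(((l : ℤ) - m - V * k : ℤ) : ℝ)| := by
      rw [← Int.cast_abs]; exact_mod_cast Int.one_le_abs hne0
    have h2 : |-(V * x) - m| ≤ 1 / 2 := abs_sub_round _
    have h3 : (((l : ℤ) - m - V * k : ℤ) : ℝ) = V * ((x + l / V) - k) + (-(V * x) - m) := by
      push_cast; field_simp; ring
    rw [h3] at h1
    have h4 := h1.trans (abs_add_le _ _)
    rw [abs_mul, abs_of_pos hV0] at h4
    rw [div_le_iff₀ (by positivity)]
    nlinarith
  rw [e1]
  have hterm : ∀ l ∈ Finset.range V,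
      ‖periodicCoeff g V l * symmSum (fun j => unitExp (j * (x + l / V))) X₁ X₂‖ ≤
        (if l = l₀ then 14 * η else 0) + 2 * V / X₁ := by
    intro l hl
    have hl' := Finset.mem_range.mp hl
    rw [norm_mul]
    split_ifs with h
    · have h1 := mul_le_mul (hη l hl') (norm_symmSum_unitExp_le (x + l / V) (X₂ := X₂) hX)
        (norm_nonneg _) hη0
      have : (0 : ℝ) ≤ 2 * V / X₁ := by positivity
      linarith
    · have h1 := norm_symmSum_unitExp_mul_le (x + l / V) (X₂ := X₂) hX
      have h2 := hfar l hl' h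
      have h3 := norm_periodicCoeff_le_one hg V l
      set S := ‖symmSum (fun j => unitExp (j * (x + l / V))) X₁ X₂‖ with hS
      have hS0 : 0 ≤ S := norm_nonneg _
      have h4 : S * (X₁ * (1 / (2 * V))) ≤ 1 :=
        (mul_le_mul_of_nonneg_left (mul_le_mul_of_nonneg_left h2 hX0.le) hS0).trans h1
      have h5 : S ≤ 2 * V / X₁ := by
        rw [le_div_iff₀ hX0]
        have e : S * (X₁ * (1 / (2 * V))) = S * X₁ / (2 * V) := by ring
        rw [e, div_le_one (by positivity)] at h4
        exact h4
      rw [zero_add]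
      exact (mul_le_of_le_one_left hS0 h3).trans h5
  refine (norm_sum_le_of_le _ hterm).trans ?_
  rw [Finset.sum_add_distrib, Finset.sum_ite_eq', Finset.sum_const, Finset.card_range, nsmul_eq_mul]
  have h1 : (if l₀ ∈ Finset.range V then 14 * η else 0) ≤ 14 * η := by
    split_ifs <;> linarith
  have h2 : (V : ℝ) * (2 * V / X₁) = 2 * V ^ 2 / X₁ := by ring
  linarith

/-! ### The polynomial A and the phases at rational time -/

theorem coeff_polyA (n : ℕ) (α : ℕ → ℤ) (θ : ℝ) (k : ℕ) : (polyA n α θ).coeff k =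
    ∑ m ∈ Finset.Icc 2 n,
      if k ∈ Finset.Icc 2 m then (α m : ℝ) * (m.choose k : ℝ) * θ ^ (m - k) else 0 := by
  rw [polyA, Polynomial.finsetSum_coeff]
  refine Finset.sum_congr rfl fun m _ => ?_
  rw [Polynomial.finsetSum_coeff]
  simp_rw [Polynomial.coeff_C_mul_X_pow]
  rw [Finset.sum_ite_eq]

theorem coeff_polyA_eq_zero {n : ℕ} (α : ℕ → ℤ) (θ : ℝ) {k : ℕ} (hk : n < k) :
    (polyA n α θ).coeff k = 0 := by
  rw [coeff_polyA]
  refine Finset.sum_eq_zero fun m hm => if_neg fun h => ?_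
  simp only [Finset.mem_Icc] at hm h
  omega

theorem natDegree_polyA_le (n : ℕ) (α : ℕ → ℤ) (θ : ℝ) : (polyA n α θ).natDegree ≤ n :=
  Polynomial.natDegree_le_iff_coeff_eq_zero.mpr fun _ hk => coeff_polyA_eq_zero α θ hk

theorem coeff_polyA_self (e : ℕ) (α : ℕ → ℤ) (θ : ℝ) :
    (polyA (e + 2) α θ).coeff (e + 2) = α (e + 2) := by
  rw [coeff_polyA, Finset.sum_eq_single (e + 2)]
  · simp
  · intro m hm hne
    refine if_neg fun h => ?_
    simp only [Finset.mem_Icc] at hm h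
    omega
  · intro h; simp at h

/-- The highest coefficient in which θ appears; its θ-part is what survives modulo 1 at the rational
time. -/
theorem coeff_polyA_pred {e : ℕ} (he : 1 ≤ e) (α : ℕ → ℤ) (θ : ℝ) :
    (polyA (e + 2) α θ).coeff (e + 1) = α (e + 1) + (e + 2) * α (e + 2) * θ := by
  rw [coeff_polyA, Finset.sum_Icc_succ_top (by omega), Finset.sum_eq_single (e + 1)]
  · rw [if_pos (by simp; omega), if_pos (by simp; omega)]
    have : (e + 1 + 1).choose (e + 1) = e + 2 := Nat.choose_succ_self_right (e + 1)
    rw [this, Nat.choose_self, Nat.sub_self, show e + 1 + 1 - (e + 1) = 1 by omega]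
    push_cast
    ring
  · intro m hm hne
    refine if_neg fun h => ?_
    simp only [Finset.mem_Icc] at hm h
    omega
  · intro h; simp at h; omega

/-- The phase, in units of full turns, acquired by the `j`-th mode at time `2π p / q`. -/
noncomputable def modePhase (e : ℕ) (α : ℕ → ℤ) (p q : ℕ) (θ : ℝ) (j : ℤ) : ℝ :=
  -(p / q : ℝ) * (polyA (e + 2) α θ).eval (j : ℝ)

theorem natDegree_comp_linear_le {P : ℝ[X]} {d : ℕ} (hP : P.natDegree ≤ d) (a b : ℝ) :
    (P.comp (C a * X + C b)).natDegree ≤ d :=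
  Polynomial.natDegree_comp_le.trans
    ((Nat.mul_le_mul hP Polynomial.natDegree_linear_le).trans (by rw [mul_one]))

theorem coeff_comp_linear {P : ℝ[X]} {d : ℕ} (hP : P.natDegree ≤ d) {a : ℝ} (ha : a ≠ 0) (b : ℝ) :
    (P.comp (C a * X + C b)).coeff d = P.coeff d * a ^ d := by
  rcases hP.lt_or_eq with h | h
  · rw [Polynomial.coeff_eq_zero_of_natDegree_lt h, zero_mul]
    exact Polynomial.coeff_eq_zero_of_natDegree_lt
      ((natDegree_comp_linear_le le_rfl a b).trans_lt h)
  · have h1 := Polynomial.coeff_comp_degree_mul_degree (p := P) (q := C a * X + C b)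
      (by rw [Polynomial.natDegree_linear ha]; exact one_ne_zero)
    rw [Polynomial.natDegree_linear ha, mul_one, h, Polynomial.leadingCoeff_linear ha] at h1
    rw [h1, ← h]; rfl

/-- The integer `p q^(n-2) α_n n!` with `n = e + 2`. -/
def phaseMultiplier (e : ℕ) (α : ℕ → ℤ) (p q : ℕ) : ℤ :=
  p * q ^ e * α (e + 2) * (e + 2).factorial

/-- On the progression ml + s with m = ±q, the powers (ml + s)^k are congruent to s^k mod q. Terms
with coefficient in (p/q)ℤ are therefore constant modulo 1, and the remaining polynomial has degree
at most e + 1. Its top difference is (e + 1)! times the coefficient times m^(e+1). The choice m = -q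
serves the negative modes. -/
theorem hasPhase_modePhase {e : ℕ} (he : 1 ≤ e) (α : ℕ → ℤ) (p : ℕ) {q : ℕ} (hq : 0 < q) (θ x : ℝ)
    {m : ℤ} (hm : m = q ∨ m = -q) (s : ℤ) :
    ∃ σ : ℤ, (σ = 1 ∨ σ = -1) ∧ HasPhase (e + 1) (σ * (phaseMultiplier e α p q * θ))
      (fun l => modePhase e α p q θ (m * l + s) + ((m * l + s : ℤ) : ℝ) * x) := by
  have hq0 : (q : ℝ) ≠ 0 := by positivity
  -- The added monomials cancel the whole term of degree e + 2 and the θ-free part of the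
  -- coefficient of degree e + 1.
  set Q : ℝ[X] := C (-(p / q : ℝ)) * polyA (e + 2) α θ + C x * X +
    C (p / q * α (e + 2) : ℝ) * X ^ (e + 2) + C (p / q * α (e + 1) : ℝ) * X ^ (e + 1) with hQ
  have hQdeg : Q.natDegree ≤ e + 1 := by
    refine Polynomial.natDegree_le_iff_coeff_eq_zero.mpr fun k hk => ?_
    rw [hQ]
    simp only [Polynomial.coeff_add, Polynomial.coeff_C_mul, Polynomial.coeff_X_pow,
      Polynomial.coeff_X]
    rw [if_neg (by omega : ¬ 1 = k), if_neg (by omega : ¬ k = e + 1)]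
    rcases eq_or_ne k (e + 2) with rfl | hne
    · rw [coeff_polyA_self, if_pos rfl]; ring
    · rw [coeff_polyA_eq_zero α θ (by omega), if_neg hne]; ring
  have hQcoeff : Q.coeff (e + 1) = -(p / q : ℝ) * ((e + 2) * α (e + 2) * θ) := by
    rw [hQ]
    simp only [Polynomial.coeff_add, Polynomial.coeff_C_mul, Polynomial.coeff_X_pow,
      Polynomial.coeff_X]
    rw [if_neg (by omega : ¬ 1 = e + 1), if_neg (by omega : ¬ e + 1 = e + 2), if_pos trivial,
      coeff_polyA_pred he]
    ring
  have hm0 : (m : ℝ) ≠ 0 := by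
    rcases hm with rfl | rfl
    · simpa using hq0
    · simpa using hq0
  obtain ⟨ρ, hρ, hmρ⟩ : ∃ ρ : ℤ, (ρ = 1 ∨ ρ = -1) ∧ m = ρ * q := by
    rcases hm with rfl | rfl
    · exact ⟨1, Or.inl rfl, by ring⟩
    · exact ⟨-1, Or.inr rfl, by ring⟩
  have hρpow : ∀ k : ℕ, ρ ^ k = 1 ∨ ρ ^ k = -1 := by
    intro k
    rcases hρ with rfl | rfl
    · exact Or.inl (one_pow k)
    · exact neg_one_pow_eq_or ℤ k
  refine ⟨-ρ ^ (e + 1), ?_, ?_⟩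
  · rcases hρpow (e + 1) with h | h <;> rw [h] <;> simp
  set c : ℝ := (p / q : ℝ) * (α (e + 2) * s ^ (e + 2) + α (e + 1) * s ^ (e + 1))
  have h1 := (HasPhase.of_polynomial (natDegree_comp_linear_le hQdeg (m : ℝ) (s : ℝ))).add
    ((HasPhase.of_polynomial (d := e + 1) (P := C (-c)) (by simp)).add
    (HasPhase.of_intCast (d := e + 1) (F := fun l : ℕ => -(p / q : ℝ) *
      (α (e + 2) * (((m * l + s : ℤ) : ℝ) ^ (e + 2) - s ^ (e + 2)) +
        α (e + 1) * (((m * l + s : ℤ) : ℝ) ^ (e + 1) - s ^ (e + 1)))) (fun l => by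
      have hdvd : ∀ k : ℕ, (q : ℤ) ∣ (m * l + s) ^ k - s ^ k := by
        intro k
        refine dvd_trans ?_ (sub_dvd_pow_sub_pow (m * l + s) s k)
        rw [hmρ]
        exact ⟨ρ * l, by ring⟩
      obtain ⟨a, ha⟩ := hdvd (e + 2)
      obtain ⟨b, hb⟩ := hdvd (e + 1)
      have ha' : (((m * l + s : ℤ) : ℝ) ^ (e + 2) - s ^ (e + 2)) = q * a := by exact_mod_cast ha
      have hb' : (((m * l + s : ℤ) : ℝ) ^ (e + 1) - s ^ (e + 1)) = q * b := by exact_mod_cast hb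
      refine ⟨-(p * (α (e + 2) * a + α (e + 1) * b)), ?_⟩
      rw [ha', hb']
      push_cast
      field_simp)))
  convert h1 using 1
  · rw [coeff_comp_linear hQdeg hm0, hQcoeff, Polynomial.coeff_C, if_neg (by omega), hmρ,
      phaseMultiplier, Nat.factorial_succ (e + 1)]
    push_cast
    field_simp
    ring
  · funext l
    rw [Polynomial.eval_comp, hQ, modePhase]
    simp only [Polynomial.eval_add, Polynomial.eval_mul, Polynomial.eval_C, Polynomial.eval_X,
      Polynomial.eval_pow]
    push_cast
    ring

/-! ### Near-rational numbers -/

/-- `β` is within `K ^ C / N ^ d` of a rational, in the sense of multiples with denominator at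
most `K ^ C`. -/
def NearRational (C d : ℕ) (β K : ℝ) (N : ℕ) : Prop :=
  ∃ (v : ℕ) (b : ℤ), 0 < v ∧ (v : ℝ) ≤ K ^ C ∧ |v * β - b| ≤ K ^ C / (N : ℝ) ^ d

/-- C does not depend on θ, so that the same constant serves both θ and its rational approximant θ'
in the stage estimate. -/
theorem exists_nearRational_of_large_sum {e : ℕ} (he : 1 ≤ e) (α : ℕ → ℤ) (p : ℕ) {q : ℕ}
    (hq : 0 < q) : ∃ C : ℕ, 1 ≤ C ∧ ∀ (θ x : ℝ) (m s : ℤ), (m = q ∨ m = -q) →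
      ∀ (N L : ℕ) (K : ℝ), 1 ≤ N → L ≤ N → 2 ≤ K →
      N / K ≤ ‖∑ l ∈ Finset.range L,
        unitExp (modePhase e α p q θ (m * l + s) + ((m * l + s : ℤ) : ℝ) * x)‖ →
      NearRational C (e + 1) (phaseMultiplier e α p q * θ) K N := by
  obtain ⟨C, hC⟩ := exists_small_denominator_of_large_weyl_sum e
  refine ⟨C + 1, by omega, fun θ x m s hm N L K hN hL hK hS => ?_⟩
  obtain ⟨σ, hσ, hF⟩ := hasPhase_modePhase he α p hq θ x hm s
  obtain ⟨v, a, hv0, hv, hva⟩ := hC _ _ hF N L K hN hL hK hS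
  have hle : K ^ C ≤ K ^ (C + 1) := pow_le_pow_right₀ (by linarith) (by omega)
  refine ⟨v, σ * a, hv0, hv.trans hle, ?_⟩
  refine le_trans (le_trans (le_of_eq ?_) hva) (by gcongr)
  rcases hσ with rfl | rfl
  · push_cast; congr 1; ring
  · rw [← abs_neg]; push_cast; congr 1; ring

theorem NearRational.exists_coprime {C d : ℕ} {β K : ℝ} {N : ℕ} (h : NearRational C d β K N) :
    ∃ (v : ℕ) (b : ℤ), IsCoprime b (v : ℤ) ∧ 0 < v ∧ (v : ℝ) ≤ K ^ C ∧
      |v * β - b| ≤ K ^ C / (N : ℝ) ^ d := by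
  obtain ⟨v, b, hv0, hv, hvb⟩ := h
  have hg : 0 < Int.gcd b v := Int.gcd_pos_of_ne_zero_right _ (by exact_mod_cast hv0.ne')
  obtain ⟨b', v', hcop, hb, hv'⟩ := Int.exists_gcd_one hg
  set g := Int.gcd b v
  have hg1 : (1 : ℝ) ≤ g := by exact_mod_cast hg
  have hv'0 : 0 < v' := by
    have h1 : 0 < v' * (g : ℤ) := by rw [← hv']; exact_mod_cast hv0
    exact pos_of_mul_pos_left h1 (by positivity)
  lift v' to ℕ using hv'0.le
  have hvR : (v : ℝ) = v' * g := by exact_mod_cast hv'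
  have hbR : (b : ℝ) = b' * g := by exact_mod_cast hb
  refine ⟨v', b', Int.isCoprime_iff_gcd_eq_one.mpr hcop, by exact_mod_cast hv'0,
    le_trans ?_ hv, le_trans ?_ hvb⟩
  · rw [hvR]; exact le_mul_of_one_le_right (by positivity) hg1
  · have : (v : ℝ) * β - b = (v' * β - b') * g := by rw [hvR, hbR]; ring
    rw [this, abs_mul, Nat.abs_cast]
    exact le_mul_of_one_le_right (abs_nonneg _) hg1

/-- If v does not divide v', then v'b/v is at distance at least 1/v from every integer. As W^d ≥ v²,
the permitted error K^C/W^d then forces v ≤ K^C. -/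
theorem NearRational.denominator_le {C d : ℕ} {K : ℝ} {W v : ℕ} {b : ℤ} (hd : 1 ≤ d)
    (hv0 : 0 < v) (hcop : IsCoprime b (v : ℤ)) (hW : v ^ 2 ≤ W)
    (h : NearRational C d (b / v) K W) : (v : ℝ) ≤ K ^ C := by
  obtain ⟨v', b', hv'0, hv', hb'⟩ := h
  have hvR : (0 : ℝ) < v := by exact_mod_cast hv0
  by_cases hdvd : v ∣ v'
  · refine le_trans ?_ hv'
    exact_mod_cast Nat.le_of_dvd hv'0 hdvd
  have hne : (v' : ℤ) * b - v * b' ≠ 0 := by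
    intro h0
    refine hdvd ?_
    have : (v : ℤ) ∣ v' * b := ⟨b', by linarith⟩
    exact_mod_cast hcop.symm.dvd_of_dvd_mul_right this
  have h1 : (1 : ℝ) ≤ |(((v' : ℤ) * b - v * b' : ℤ) : ℝ)| := by
    rw [← Int.cast_abs]; exact_mod_cast Int.one_le_abs hne
  have e : (((v' : ℤ) * b - v * b' : ℤ) : ℝ) = v * (v' * (b / v) - b') := by
    push_cast; field_simp
  rw [e, abs_mul, abs_of_pos hvR] at h1
  have hv1 : (1 : ℝ) ≤ v := by exact_mod_cast hv0
  have hWR : (v : ℝ) ^ 2 ≤ (W : ℝ) ^ d := by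
    have h2 : (v : ℝ) ^ 2 ≤ W := by exact_mod_cast hW
    exact h2.trans (le_self_pow₀ (le_trans (one_le_pow₀ hv1) h2) (by omega))
  have hWpos : (0 : ℝ) < (W : ℝ) ^ d := lt_of_lt_of_le (by positivity) hWR
  rw [le_div_iff₀ hWpos] at hb'
  have hKC : 0 ≤ K ^ C := le_trans (Nat.cast_nonneg _) hv'
  set t := |(v' : ℝ) * (b / v) - b'|
  have ht0 : 0 ≤ t := abs_nonneg _
  have h3 : t * (v : ℝ) ^ 2 ≤ K ^ C := (mul_le_mul_of_nonneg_left hWR ht0).trans hb'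
  nlinarith

/-! ### Dyadic blocks, perturbation of θ and rational θ -/

section

variable {e : ℕ} (α : ℕ → ℤ) (p : ℕ) {q : ℕ}

/-- The modes at time `2π p / q`, evaluated at `2π x`. -/
noncomputable def modeValue (e : ℕ) (α : ℕ → ℤ) (p q : ℕ) (θ x : ℝ) (j : ℤ) : ℂ :=
  unitExp (modePhase e α p q θ j) * unitExp (j * x)

theorem norm_symmSum_dyadic_block_le {C : ℕ} (hq : 0 < q) {θ K : ℝ} {N : ℕ} (hN : 0 < N)
    (hK : 2 ≤ K)
    (hC : ∀ (x : ℝ) (m s : ℤ), (m = q ∨ m = -q) → ∀ L ≤ N,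
      N / K ≤ ‖∑ l ∈ Finset.range L,
        unitExp (modePhase e α p q θ (m * l + s) + ((m * l + s : ℤ) : ℝ) * x)‖ →
      NearRational C (e + 1) (phaseMultiplier e α p q * θ) K N)
    (hnot : ¬ NearRational C (e + 1) (phaseMultiplier e α p q * θ) K N) (x : ℝ) :
    ‖symmSum (modeValue e α p q θ x) (q * N) (q * (2 * N))‖ ≤ 2 / K := by
  have hN0 : (0 : ℝ) < N := by exact_mod_cast hN
  have h1 : ∀ (m s : ℤ), (m = q ∨ m = -q) → ∀ L ≤ N,
      ‖∑ l ∈ Finset.range L, modeValue e α p q θ x (m * l + s)‖ ≤ N / K := by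
    intro m s hm L hL
    by_contra hcon
    refine hnot (hC x m s hm L hL ((not_le.mp hcon).le.trans (le_of_eq ?_)))
    simp_rw [modeValue, ← unitExp_add]
  have h2 := norm_sum_div_le_of_residues (a := fun j => modeValue e α p q θ x j) (B := N / K) hq hN
    (fun r _ L hL => by
      have := h1 q (q * N + r) (Or.inl rfl) L hL
      refine le_trans (le_of_eq ?_) this
      congr 1
      refine Finset.sum_congr rfl fun l _ => ?_
      congr 1; push_cast; ring)
  have h3 := norm_sum_div_le_of_residues (a := fun j => modeValue e α p q θ x (-j)) (B := N / K)
    hq hN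
    (fun r _ L hL => by
      have := h1 (-q) (-(q * N + r)) (Or.inr rfl) L hL
      refine le_trans (le_of_eq ?_) this
      congr 1
      refine Finset.sum_congr rfl fun l _ => ?_
      congr 1; push_cast; ring)
  have e1 : (N / K : ℝ) / N = 1 / K := by field_simp
  rw [e1] at h2 h3
  simp_rw [symmSum, sub_div, Finset.sum_sub_distrib]
  refine (norm_sub_le _ _).trans ((add_le_add h2 h3).trans (le_of_eq ?_))
  ring

/-- The terms of A with k = m do not involve θ, so the difference of phases grows only like
|j|^(e+1). The bound 2 leaves room for an approximant outside (0,1). -/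
theorem exists_abs_modePhase_sub_le (e : ℕ) (q : ℕ) : ∃ c : ℝ, 0 ≤ c ∧ ∀ θ θ' : ℝ, |θ| ≤ 2 →
    |θ'| ≤ 2 → ∀ j : ℤ, |modePhase e α p q θ j - modePhase e α p q θ' j| ≤
      c * |θ - θ'| * |(j : ℝ)| ^ (e + 1) := by
  set c : ℝ := (p / q : ℝ) * ∑ m ∈ Finset.Icc 2 (e + 2), ∑ k ∈ Finset.Icc 2 m,
    |(α m : ℝ) * (m.choose k : ℝ)| * ((m - k : ℕ) * 2 ^ (m - k - 1)) with hc
  refine ⟨c, by positivity, fun θ θ' hθ hθ' j => ?_⟩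
  have h1 : modePhase e α p q θ j - modePhase e α p q θ' j = -(p / q : ℝ) *
      ∑ m ∈ Finset.Icc 2 (e + 2), ∑ k ∈ Finset.Icc 2 m,
        (α m : ℝ) * (m.choose k : ℝ) * (θ ^ (m - k) - θ' ^ (m - k)) * (j : ℝ) ^ k := by
    rw [modePhase, modePhase, ← mul_sub, polyA, polyA]
    simp only [Polynomial.eval_finsetSum, Polynomial.eval_mul, Polynomial.eval_C,
      Polynomial.eval_pow, Polynomial.eval_X, ← Finset.sum_sub_distrib]
    congr 1
    refine Finset.sum_congr rfl fun m _ => Finset.sum_congr rfl fun k _ => ?_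
    ring
  rw [h1, abs_mul, abs_neg, abs_of_nonneg (by positivity : (0 : ℝ) ≤ p / q), hc,
    mul_assoc, mul_assoc]
  refine mul_le_mul_of_nonneg_left ?_ (by positivity)
  rw [Finset.sum_mul]
  refine (Finset.abs_sum_le_sum_abs _ _).trans (Finset.sum_le_sum fun m hm => ?_)
  rw [Finset.sum_mul]
  refine (Finset.abs_sum_le_sum_abs _ _).trans (Finset.sum_le_sum fun k hk => ?_)
  simp only [Finset.mem_Icc] at hm hk
  rw [abs_mul, abs_mul, mul_assoc, mul_assoc]
  refine mul_le_mul_of_nonneg_left ?_ (abs_nonneg _)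
  have h2 : |θ ^ (m - k) - θ' ^ (m - k)| ≤ ((m - k : ℕ) * 2 ^ (m - k - 1)) * |θ - θ'| := by
    refine (abs_pow_sub_pow_le θ θ' (m - k)).trans ?_
    have : max |θ| |θ'| ^ (m - k - 1) ≤ 2 ^ (m - k - 1) :=
      pow_le_pow_left₀ (le_max_of_le_left (abs_nonneg _)) (max_le hθ hθ') _
    calc |θ - θ'| * (m - k : ℕ) * max |θ| |θ'| ^ (m - k - 1)
        ≤ |θ - θ'| * (m - k : ℕ) * 2 ^ (m - k - 1) := by gcongr
      _ = _ := by ring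
  rcases eq_or_lt_of_le hk.2 with rfl | hlt
  · rw [Nat.sub_self, pow_zero, pow_zero, sub_self, abs_zero, zero_mul]; positivity
  have h3 : |(j : ℝ) ^ k| ≤ |(j : ℝ)| ^ (e + 1) := by
    rw [abs_pow]
    rcases eq_or_ne j 0 with rfl | hj
    · rw [Int.cast_zero, abs_zero, zero_pow (by omega), zero_pow (by omega)]
    · refine pow_le_pow_right₀ ?_ (by omega)
      rw [← Int.cast_abs]; exact_mod_cast Int.one_le_abs hj
  rw [← mul_assoc]
  exact mul_le_mul h2 h3 (abs_nonneg _) (by positivity)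

theorem norm_symmSum_sub_symmSum_le {θ θ' c : ℝ} (hc : 0 ≤ c)
    (hdiff : ∀ j : ℤ, |modePhase e α p q θ j - modePhase e α p q θ' j| ≤
      c * |θ - θ'| * |(j : ℝ)| ^ (e + 1)) (x : ℝ) {X₁ X₂ : ℕ} (hX : 0 < X₁) :
    ‖symmSum (modeValue e α p q θ x) X₁ X₂ - symmSum (modeValue e α p q θ' x) X₁ X₂‖ ≤
      4 * Real.pi * c * |θ - θ'| * (X₂ : ℝ) ^ (e + 1) := by
  have h1 : ∀ j : ℤ, ‖modeValue e α p q θ x j - modeValue e α p q θ' x j‖ ≤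
      2 * Real.pi * (c * |θ - θ'| * |(j : ℝ)| ^ (e + 1)) := by
    intro j
    rw [modeValue, modeValue, ← sub_mul, norm_mul, norm_unitExp, mul_one]
    exact (norm_unitExp_sub_le _ _).trans
      (mul_le_mul_of_nonneg_left (hdiff j) (by positivity))
  rw [symmSum, symmSum, ← Finset.sum_sub_distrib]
  have h2 : ∀ j ∈ Finset.Ico X₁ X₂,
      ‖(modeValue e α p q θ x j - modeValue e α p q θ x (-j)) / (j : ℂ) -
        (modeValue e α p q θ' x j - modeValue e α p q θ' x (-j)) / (j : ℂ)‖ ≤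
      4 * Real.pi * c * |θ - θ'| * (X₂ : ℝ) ^ e := by
    intro j hj
    obtain ⟨hj1, hj2⟩ := Finset.mem_Ico.mp hj
    have hj0 : (0 : ℝ) < j := by exact_mod_cast hX.trans_le hj1
    have e1 : (modeValue e α p q θ x j - modeValue e α p q θ x (-j)) / (j : ℂ) -
        (modeValue e α p q θ' x j - modeValue e α p q θ' x (-j)) / (j : ℂ) =
        ((modeValue e α p q θ x j - modeValue e α p q θ' x j) -
        (modeValue e α p q θ x (-j) - modeValue e α p q θ' x (-j))) / (j : ℂ) := by ring
    rw [e1, norm_div, Complex.norm_natCast, div_le_iff₀ hj0]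
    refine (norm_sub_le _ _).trans ((add_le_add (h1 j) (h1 (-j))).trans ?_)
    rw [Int.cast_neg, abs_neg, Int.cast_natCast, Nat.abs_cast]
    have h3 : (j : ℝ) ^ e ≤ (X₂ : ℝ) ^ e :=
      pow_le_pow_left₀ hj0.le (by exact_mod_cast hj2.le) _
    calc 2 * Real.pi * (c * |θ - θ'| * (j : ℝ) ^ (e + 1)) +
          2 * Real.pi * (c * |θ - θ'| * (j : ℝ) ^ (e + 1))
        = 4 * Real.pi * c * |θ - θ'| * (j : ℝ) ^ e * j := by ring
      _ ≤ _ := by gcongr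
  refine (norm_sum_le_of_le _ h2).trans ?_
  rw [Finset.sum_const, Nat.card_Ico, nsmul_eq_mul]
  have h3 : ((X₂ - X₁ : ℕ) : ℝ) ≤ X₂ := by exact_mod_cast Nat.sub_le _ _
  calc ((X₂ - X₁ : ℕ) : ℝ) * (4 * Real.pi * c * |θ - θ'| * (X₂ : ℝ) ^ e)
      ≤ X₂ * (4 * Real.pi * c * |θ - θ'| * (X₂ : ℝ) ^ e) := by gcongr
    _ = _ := by ring

/-- For rational `θ` the phases are periodic modulo `1`. -/
theorem modePhase_add_period (e : ℕ) (hq : 0 < q) (a : ℤ) {w : ℕ} (hw : 0 < w) (j : ℤ) :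
    ∃ k : ℤ, modePhase e α p q (a / w) (j + (q * w ^ (e + 2) : ℕ)) =
      modePhase e α p q (a / w) j + k := by
  have hw0 : (w : ℝ) ≠ 0 := by positivity
  have hq0 : (q : ℝ) ≠ 0 := by positivity
  have hdvd : ∀ k : ℕ, ∃ t : ℤ, (j + (q * w ^ (e + 2) : ℕ) : ℤ) ^ k - j ^ k =
      (q * w ^ (e + 2) : ℕ) * t := by
    intro k
    have := sub_dvd_pow_sub_pow (j + (q * w ^ (e + 2) : ℕ) : ℤ) j k
    rwa [add_sub_cancel_left] at this
  choose t ht using hdvd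
  refine ⟨-(p * ∑ m ∈ Finset.Icc 2 (e + 2), ∑ k ∈ Finset.Icc 2 m,
    α m * m.choose k * a ^ (m - k) * w ^ (e + 2 - (m - k)) * t k), ?_⟩
  rw [modePhase, modePhase, ← sub_eq_iff_eq_add', ← mul_sub, polyA]
  simp only [Polynomial.eval_finsetSum, Polynomial.eval_mul, Polynomial.eval_C,
      Polynomial.eval_pow, Polynomial.eval_X, ← Finset.sum_sub_distrib]
  push_cast
  rw [neg_mul, neg_inj, Finset.mul_sum, Finset.mul_sum]
  refine Finset.sum_congr rfl fun m hm => ?_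
  rw [Finset.mul_sum, Finset.mul_sum]
  refine Finset.sum_congr rfl fun k hk => ?_
  simp only [Finset.mem_Icc] at hm hk
  have ht' : ((j : ℝ) + q * w ^ (e + 2)) ^ k - (j : ℝ) ^ k = q * w ^ (e + 2) * t k := by
    exact_mod_cast ht k
  have hpow : (w : ℝ) ^ (e + 2) = w ^ (m - k) * w ^ (e + 2 - (m - k)) := by
    rw [← pow_add]; congr 1; omega
  rw [← mul_sub, ht', hpow, div_pow]
  field_simp

/-- A coefficient is an average over q residue classes of Weyl sums of length W, the character mod
qW being absorbed into the linear phase. -/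
theorem norm_periodicCoeff_modePhase_le {C : ℕ} (hq : 0 < q) {θ K : ℝ} {W : ℕ} (hW : 0 < W)
    (hC : ∀ (x : ℝ) (m s : ℤ), (m = q ∨ m = -q) → ∀ L ≤ W,
      W / K ≤ ‖∑ l ∈ Finset.range L,
        unitExp (modePhase e α p q θ (m * l + s) + ((m * l + s : ℤ) : ℝ) * x)‖ →
      NearRational C (e + 1) (phaseMultiplier e α p q * θ) K W)
    (hnot : ¬ NearRational C (e + 1) (phaseMultiplier e α p q * θ) K W) (l : ℕ) :
    ‖periodicCoeff (fun j => unitExp (modePhase e α p q θ j)) (q * W) l‖ ≤ 1 / K := by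
  have hq0 : (0 : ℝ) < q := by exact_mod_cast hq
  have hW0 : (0 : ℝ) < W := by exact_mod_cast hW
  rw [periodicCoeff, norm_div, Complex.norm_natCast, div_le_iff₀ (by positivity),
    sum_range_mul_eq]
  have h1 : ∀ r ∈ Finset.range q, ‖∑ i ∈ Finset.range W,
      unitExp (modePhase e α p q θ ((q * i + r : ℕ) : ℤ)) *
        unitExp (-(((q * i + r : ℕ) : ℤ) * (l / (q * W : ℕ) : ℝ)))‖ ≤ W / K := by
    intro r _
    by_contra hcon
    refine hnot (hC (-(l / (q * W : ℕ) : ℝ)) q r (Or.inl rfl) W le_rfl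
      ((not_le.mp hcon).le.trans (le_of_eq ?_)))
    congr 1
    refine Finset.sum_congr rfl fun i _ => ?_
    rw [← unitExp_add]
    congr 1
    push_cast
    ring
  refine (norm_sum_le_of_le _ h1).trans (le_of_eq ?_)
  rw [Finset.sum_const, Finset.card_range, nsmul_eq_mul]
  push_cast
  ring

end

/-! ### Stages between consecutive levels of approximation -/

theorem norm_symmSum_dyadic_le {u : ℤ → ℂ} {q k₀ : ℕ} {B : ℝ}
    (h : ∀ k ≥ k₀, ‖symmSum u (q * 2 ^ k) (q * (2 * 2 ^ k))‖ ≤ B) {k : ℕ} (hk : k₀ ≤ k) (t : ℕ) :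
    ‖symmSum u (q * 2 ^ k) (q * 2 ^ (k + t))‖ ≤ t * B := by
  induction t with
  | zero => simp [symmSum]
  | succ t ih =>
    have hmono : ∀ {i j : ℕ}, i ≤ j → q * 2 ^ i ≤ q * 2 ^ j := fun hij =>
      Nat.mul_le_mul_left q (Nat.pow_le_pow_right two_pos hij)
    rw [← symmSum_add_symmSum u (hmono (Nat.le_add_right k t)) (hmono (by omega))]
    have h1 := h (k + t) (by omega)
    rw [← pow_succ', add_assoc] at h1
    refine (norm_add_le _ _).trans ((add_le_add ih h1).trans (le_of_eq ?_))
    push_cast; ring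

/-- Every block past k₀ is O(2^(-i)), but k₁ - k₀ is not bounded in terms of i. In a long stage, the
near-rationality just before k₁ supplies one rational θ' that controls all blocks but O(i) of them
at once, through the bound for periodic multipliers. -/
theorem exists_norm_symmSum_stage_le {e : ℕ} (he : 1 ≤ e) (α : ℕ → ℤ) (p : ℕ) {q : ℕ}
    (hq : 0 < q) (hB : phaseMultiplier e α p q ≠ 0) : ∃ (C : ℕ) (c : ℝ), 1 ≤ C ∧ 0 ≤ c ∧
      ∀ θ ∈ Set.Ioo (0 : ℝ) 1, ∀ i k₀ k₁ : ℕ, 1 ≤ i → k₀ ≤ k₁ →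
      (∀ k ≥ k₀, ¬ NearRational C (e + 1) (phaseMultiplier e α p q * θ) (2 ^ i) (2 ^ k)) →
      (k₀ < k₁ → NearRational C (e + 1) (phaseMultiplier e α p q * θ) (2 ^ (i + 1))
        (2 ^ (k₁ - 1))) →
      ∀ x : ℝ, ‖symmSum (modeValue e α p q θ x) (q * 2 ^ k₀) (q * 2 ^ k₁)‖ ≤
        c * (i + 1) / 2 ^ i := by
  obtain ⟨C, hC1, hC⟩ := exists_nearRational_of_large_sum he α p hq
  obtain ⟨c₀, hc₀, hdiff⟩ := exists_abs_modePhase_sub_le α p e q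
  set B : ℤ := phaseMultiplier e α p q with hBdef
  set D : ℕ := 2 * C * (e + 2) + C + 2 with hD
  have hq0 : (0 : ℝ) < q := by exact_mod_cast hq
  set c : ℝ := 4 * D + 14 + 2 * (q ^ 2 * (B.natAbs : ℝ) ^ (2 * (e + 2))) +
    4 * Real.pi * c₀ * q ^ (e + 1) with hc
  refine ⟨C, c, hC1, by positivity, fun θ hθ i k₀ k₁ hi hk hgood hbad x => ?_⟩
  have h2i : (0 : ℝ) < 2 ^ i := by positivity
  have hKi : (2 : ℝ) ≤ 2 ^ i := by
    simpa using pow_le_pow_right₀ (by norm_num : (1 : ℝ) ≤ 2) hi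
  set u := modeValue e α p q θ x with hu
  have hblock : ∀ k ≥ k₀, ‖symmSum u (q * 2 ^ k) (q * (2 * 2 ^ k))‖ ≤ 2 / 2 ^ i := fun k hk' =>
    norm_symmSum_dyadic_block_le α p hq (by positivity) hKi
      (fun x m s hm L hL => hC θ x m s hm (2 ^ k) L (2 ^ i) Nat.one_le_two_pow hL hKi)
      (hgood k hk') x
  -- Number of dyadic blocks given up at each end. Starting at 2^E or later makes the squared period
  -- of the rational multiplier, times 2^i, at most a constant times the starting point. Stopping E
  -- scales before k₁ makes the cost of replacing θ by θ' O(2^(-i)).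
  set E : ℕ := D * (i + 1) with hE
  have hEC : (C + 1) * (i + 1) + 1 ≤ E := by
    have h1 : (C + 2) * (i + 1) ≤ E := by rw [hE]; exact Nat.mul_le_mul_right _ (by omega)
    have h2 : (C + 2) * (i + 1) = (C + 1) * (i + 1) + 1 + i := by ring
    omega
  have hCE : C + 1 ≤ E := by
    have : C + 1 ≤ (C + 1) * (i + 1) := Nat.le_mul_of_pos_right _ (by omega)
    omega
  have hEV : (2 * C * (e + 2) + 1) * (i + 1) ≤ E := by
    rw [hE]; exact Nat.mul_le_mul_right _ (by omega)
  have hER : (E : ℝ) = D * (i + 1) := by rw [hE]; push_cast; ring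
  have hi1 : (1 : ℝ) ≤ i + 1 := by
    have : (0 : ℝ) ≤ i := Nat.cast_nonneg i
    linarith
  have hrest : 0 ≤ 14 + 2 * (q ^ 2 * (B.natAbs : ℝ) ^ (2 * (e + 2))) +
      4 * Real.pi * c₀ * q ^ (e + 1) := by positivity
  -- Otherwise there are at most 2E blocks, and the bound for a single block suffices.
  by_cases hmid : k₀ + E < k₁ ∧ 2 * E < k₁
  swap
  · obtain ⟨t, rfl⟩ := Nat.exists_eq_add_of_le hk
    have ht : t ≤ 2 * E := by omega
    refine (norm_symmSum_dyadic_le hblock le_rfl t).trans ?_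
    rw [mul_div_assoc']
    refine div_le_div_of_nonneg_right ?_ h2i.le
    have ht' : (t : ℝ) ≤ 2 * E := by exact_mod_cast ht
    have : 4 * D * ((i : ℝ) + 1) ≤ c * (i + 1) :=
      mul_le_mul_of_nonneg_right (by rw [hc]; linarith) (by linarith)
    nlinarith
  obtain ⟨hm1, hm2⟩ := hmid
  obtain ⟨v, b, hcop, hv0, hv, hvb⟩ := (hbad (by omega)).exists_coprime
  have hv0R : (0 : ℝ) < v := by exact_mod_cast hv0
  have hv1R : (1 : ℝ) ≤ v := by exact_mod_cast hv0
  -- the denominator is large at the finer threshold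
  have hvbig : ¬ (v : ℝ) ≤ (2 ^ i) ^ C := by
    intro hle
    -- Going back C dyadic scales enlarges the permitted error by at least 2^C, which makes up for
    -- the passage from (2^(i+1))^C to (2^i)^C.
    refine hgood (k₁ - 1 - C) (by omega)
      ⟨v, b, hv0, hle, hvb.trans ?_⟩
    have hsub : k₁ - 1 - C + C = k₁ - 1 := Nat.sub_add_cancel (by omega)
    rw [div_le_div_iff₀ (by positivity) (by positivity)]
    push_cast
    have h1 : ((2 : ℝ) ^ (i + 1)) ^ C = (2 ^ i) ^ C * 2 ^ C := by rw [← mul_pow, ← pow_succ]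
    have h2 : ((2 : ℝ) ^ (k₁ - 1)) ^ (e + 1) = (2 ^ (k₁ - 1 - C)) ^ (e + 1) * (2 ^ C) ^ (e + 1) := by
      rw [← mul_pow, ← pow_add, hsub]
    have h3 : (2 : ℝ) ^ C ≤ (2 ^ C) ^ (e + 1) := le_self_pow₀ (one_le_pow₀ (by norm_num)) (by omega)
    rw [h1, h2]
    calc ((2 : ℝ) ^ i) ^ C * 2 ^ C * (2 ^ (k₁ - 1 - C)) ^ (e + 1)
        ≤ (2 ^ i) ^ C * (2 ^ C) ^ (e + 1) * (2 ^ (k₁ - 1 - C)) ^ (e + 1) := by gcongr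
      _ = _ := by ring
  -- the rational approximation to `θ`
  set w : ℕ := v * B.natAbs with hw
  have hBabs : 0 < B.natAbs := Int.natAbs_pos.mpr hB
  have hw0 : 0 < w := Nat.mul_pos hv0 hBabs
  have hBR : (B : ℝ) ≠ 0 := by exact_mod_cast hB
  have hsign : (B.sign : ℝ) * B = B.natAbs := by
    rw [Nat.cast_natAbs]; exact_mod_cast Int.sign_mul_self_eq_abs B
  have hBabsR : (0 : ℝ) < B.natAbs := by exact_mod_cast hBabs
  -- The sign of B compensates for `B.natAbs` in w, so that Bθ' = b/v.
  set θ' : ℝ := ((b * B.sign : ℤ) : ℝ) / w with hθ'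
  have hBθ' : (B : ℝ) * θ' = b / v := by
    rw [hθ', hw]; push_cast
    rw [← hsign]
    have : (B.sign : ℝ) ≠ 0 := fun h => hBabsR.ne' (by rw [← hsign, h, zero_mul])
    field_simp
  have hclose : |θ - θ'| ≤ (2 ^ (i + 1)) ^ C / ((2 : ℝ) ^ (k₁ - 1)) ^ (e + 1) := by
    have h1 : (v : ℝ) * (B * θ) - b = v * B * (θ - θ') := by
      have : (v : ℝ) * (B * θ') = b := by rw [hBθ']; field_simp
      linear_combination this
    rw [h1] at hvb
    push_cast at hvb
    refine le_trans ?_ hvb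
    rw [abs_mul]
    refine le_mul_of_one_le_left (abs_nonneg _) ?_
    rw [abs_mul, Nat.abs_cast]
    have : (1 : ℝ) ≤ |(B : ℝ)| := by rw [← Int.cast_abs]; exact_mod_cast Int.one_le_abs hB
    exact one_le_mul_of_one_le_of_one_le hv1R this
  have hbound1 : ((2 : ℝ) ^ (i + 1)) ^ C / (2 ^ (k₁ - 1)) ^ (e + 1) ≤ 1 := by
    rw [div_le_one (by positivity), ← pow_mul, ← pow_mul]
    refine pow_le_pow_right₀ (by norm_num) ?_
    have : (i + 1) * C ≤ k₁ - 1 := by nlinarith [Nat.sub_add_cancel (by omega : 1 ≤ k₁)]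
    exact this.trans (Nat.le_mul_of_pos_right _ (by omega))
  have hθabs : |θ| ≤ 1 := abs_le.mpr ⟨by linarith [hθ.1], hθ.2.le⟩
  have hθ'abs : |θ'| ≤ 2 := by
    have h1 : |θ'| ≤ |θ| + |θ - θ'| := by
      have := abs_sub θ (θ - θ')
      rwa [sub_sub_cancel] at this
    linarith
  -- splitting the range of summation
  set ka := max k₀ E with hka
  set kb := k₁ - E with hkb
  have hab : ka ≤ kb := by omega
  have hmono : ∀ {i j : ℕ}, i ≤ j → q * 2 ^ i ≤ q * 2 ^ j := fun hij =>
    Nat.mul_le_mul_left q (Nat.pow_le_pow_right two_pos hij)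
  have hka0 : k₀ ≤ ka := le_max_left _ _
  have hfirst : ‖symmSum u (q * 2 ^ k₀) (q * 2 ^ ka)‖ ≤ E * (2 / 2 ^ i) := by
    obtain ⟨t, ht⟩ := Nat.exists_eq_add_of_le hka0
    rw [ht]
    refine (norm_symmSum_dyadic_le hblock le_rfl t).trans ?_
    refine mul_le_mul_of_nonneg_right ?_ (by positivity)
    exact_mod_cast (by omega : t ≤ E)
  have hlast : ‖symmSum u (q * 2 ^ kb) (q * 2 ^ k₁)‖ ≤ E * (2 / 2 ^ i) := by
    have : k₁ = kb + E := by omega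
    rw [this]
    exact norm_symmSum_dyadic_le hblock (by omega) E
  have hX1 : 0 < q * 2 ^ ka := by positivity
  have hpert : ‖symmSum u (q * 2 ^ ka) (q * 2 ^ kb) -
      symmSum (modeValue e α p q θ' x) (q * 2 ^ ka) (q * 2 ^ kb)‖ ≤
      4 * Real.pi * c₀ * q ^ (e + 1) / 2 ^ i := by
    refine (norm_symmSum_sub_symmSum_le α p hc₀ (hdiff θ θ' (by linarith) hθ'abs) x hX1).trans ?_
    have h1 : |θ - θ'| * ((2 : ℝ) ^ kb) ^ (e + 1) ≤ 1 / 2 ^ i := by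
      refine (mul_le_mul_of_nonneg_right hclose (by positivity)).trans ?_
      rw [div_mul_eq_mul_div, div_le_div_iff₀ (by positivity) (by positivity), one_mul]
      have h2 : k₁ - 1 = kb + (E - 1) := by omega
      rw [h2, pow_add (2 : ℝ) kb, mul_pow, ← pow_mul (2 : ℝ) (i + 1), mul_right_comm, ← pow_add,
        mul_comm]
      refine mul_le_mul_of_nonneg_left ?_ (by positivity)
      rw [← pow_mul]
      refine pow_le_pow_right₀ (by norm_num) ?_
      have h3 : (i + 1) * C + i ≤ E - 1 := by
        have : (C + 1) * (i + 1) = (i + 1) * C + i + 1 := by ring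
        omega
      exact h3.trans (Nat.le_mul_of_pos_right _ (by omega))
    push_cast
    rw [mul_pow]
    calc 4 * Real.pi * c₀ * |θ - θ'| * ((q : ℝ) ^ (e + 1) * (2 ^ kb) ^ (e + 1))
        = 4 * Real.pi * c₀ * q ^ (e + 1) * (|θ - θ'| * (2 ^ kb) ^ (e + 1)) := by ring
      _ ≤ 4 * Real.pi * c₀ * q ^ (e + 1) * (1 / 2 ^ i) := by gcongr
      _ = _ := by ring
  set W : ℕ := w ^ (e + 2) with hW
  have hW0 : 0 < W := by positivity
  have hcoeff : ∀ l < q * W, ‖periodicCoeff (fun j => unitExp (modePhase e α p q θ' j)) (q * W) l‖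
      ≤ 1 / 2 ^ i := fun l _ =>
    norm_periodicCoeff_modePhase_le α p hq hW0
      (fun x m s hm L hL => hC θ' x m s hm W L (2 ^ i) hW0 hL hKi)
      -- Since b/v is in lowest terms and W ≥ v², near-rationality at level 2^i would force v ≤
      -- (2^i)^C, which has been excluded.
      (fun hnear => by
        rw [← hBdef, hBθ'] at hnear
        refine hvbig (hnear.denominator_le (by omega) hv0 hcop ?_)
        calc v ^ 2 ≤ v ^ (e + 2) := Nat.pow_le_pow_right hv0 (by omega)
          _ ≤ w ^ (e + 2) := Nat.pow_le_pow_left (Nat.le_mul_of_pos_right v hBabs) _) l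
  have hmajor : ‖symmSum (modeValue e α p q θ' x) (q * 2 ^ ka) (q * 2 ^ kb)‖ ≤
      14 * (1 / 2 ^ i) + 2 * (q ^ 2 * (B.natAbs : ℝ) ^ (2 * (e + 2))) / 2 ^ i := by
    have h1 := norm_symmSum_periodic_le (g := fun j => unitExp (modePhase e α p q θ' j))
      (V := q * W) (by positivity) (fun j => by
        obtain ⟨k, hk⟩ := modePhase_add_period α p e hq (b * B.sign) hw0 j
        rw [hθ', hW]
        rw [hk, unitExp_add_intCast])
      (fun j => (norm_unitExp _).le) hcoeff x (X₂ := q * 2 ^ kb) hX1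
    refine h1.trans (add_le_add le_rfl ?_)
    rw [div_le_div_iff₀ (by positivity) h2i]
    have h2 : (v : ℝ) ^ (2 * (e + 2)) * 2 ^ i ≤ 2 ^ ka := by
      calc (v : ℝ) ^ (2 * (e + 2)) * 2 ^ i
          ≤ ((2 ^ (i + 1)) ^ C) ^ (2 * (e + 2)) * 2 ^ i := by gcongr
        _ = 2 ^ ((i + 1) * C * (2 * (e + 2)) + i) := by
          rw [← pow_mul, ← pow_mul, ← pow_add]; congr 2; ring
        _ ≤ 2 ^ ka := by
          refine pow_le_pow_right₀ (by norm_num) (le_trans ?_ ((hEV).trans (le_max_right _ _)))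
          have : (2 * C * (e + 2) + 1) * (i + 1) = (i + 1) * C * (2 * (e + 2)) + i + 1 := by ring
          omega
    have hq1 : (1 : ℝ) ≤ q := by exact_mod_cast hq
    push_cast [hW, hw]
    calc 2 * ((q : ℝ) * (v * B.natAbs) ^ (e + 2)) ^ 2 * 2 ^ i
        = 2 * (q ^ 2 * (B.natAbs : ℝ) ^ (2 * (e + 2))) * ((v : ℝ) ^ (2 * (e + 2)) * 2 ^ i) := by
          rw [pow_mul', pow_mul' (v : ℝ)]; ring
      _ ≤ 2 * (q ^ 2 * (B.natAbs : ℝ) ^ (2 * (e + 2))) * (q * 2 ^ ka) := by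
          refine mul_le_mul_of_nonneg_left (h2.trans ?_) (by positivity)
          exact le_mul_of_one_le_left (by positivity) hq1
  rw [← symmSum_add_symmSum u (hmono hka0) (hmono (hab.trans (Nat.sub_le _ _))),
    ← symmSum_add_symmSum u (hmono hab) (hmono (Nat.sub_le _ _ : kb ≤ k₁))]
  set S := symmSum u (q * 2 ^ ka) (q * 2 ^ kb)
  set S' := symmSum (modeValue e α p q θ' x) (q * 2 ^ ka) (q * 2 ^ kb)
  have hS : ‖S‖ ≤ ‖S - S'‖ + ‖S'‖ := by simpa using norm_add_le (S - S') S'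
  have htot : ‖symmSum u (q * 2 ^ k₀) (q * 2 ^ ka) + (S + symmSum u (q * 2 ^ kb) (q * 2 ^ k₁))‖ ≤
      E * (2 / 2 ^ i) + ((4 * Real.pi * c₀ * q ^ (e + 1) / 2 ^ i +
        (14 * (1 / 2 ^ i) + 2 * (q ^ 2 * (B.natAbs : ℝ) ^ (2 * (e + 2))) / 2 ^ i)) +
        E * (2 / 2 ^ i)) :=
    (norm_add_le _ _).trans (add_le_add hfirst ((norm_add_le _ _).trans
      (add_le_add (hS.trans (add_le_add hpert hmajor)) hlast)))
  refine htot.trans ?_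
  have e1 : E * (2 / 2 ^ i) + ((4 * Real.pi * c₀ * q ^ (e + 1) / 2 ^ i +
        (14 * (1 / 2 ^ i) + 2 * (q ^ 2 * (B.natAbs : ℝ) ^ (2 * (e + 2))) / 2 ^ i)) +
        E * (2 / 2 ^ i)) = (4 * (E : ℝ) + (14 + 2 * (q ^ 2 * (B.natAbs : ℝ) ^ (2 * (e + 2))) +
        4 * Real.pi * c₀ * q ^ (e + 1))) / 2 ^ i := by ring
  rw [e1]
  refine div_le_div_of_nonneg_right ?_ h2i.le
  rw [hER, hc]
  set r := 14 + 2 * (q ^ 2 * (B.natAbs : ℝ) ^ (2 * (e + 2))) + 4 * Real.pi * c₀ * q ^ (e + 1)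
  have : r ≤ r * (i + 1) := le_mul_of_one_le_right hrest hi1
  have e2 : (4 * D + 14 + 2 * (q ^ 2 * (B.natAbs : ℝ) ^ (2 * (e + 2))) +
    4 * Real.pi * c₀ * q ^ (e + 1)) * ((i : ℝ) + 1) = 4 * (D * (i + 1)) + r * (i + 1) := by ring
  rw [e2]
  linarith

/-! ### Choice of the scales -/

theorem NearRational.mono {C d : ℕ} {β K K' : ℝ} {N : ℕ} (hK : 0 ≤ K) (hKK' : K ≤ K')
    (h : NearRational C d β K N) : NearRational C d β K' N := by
  obtain ⟨v, b, hv0, hv, hvb⟩ := h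
  have := pow_le_pow_left₀ hK hKK' C
  exact ⟨v, b, hv0, hv.trans this, hvb.trans (by gcongr)⟩

theorem nearRational_of_pow_le {C d : ℕ} {β K : ℝ} {N : ℕ} (hK : 1 ≤ K) (hN : 1 ≤ N)
    (h : (N : ℝ) ^ d ≤ K ^ C) : NearRational C d β K N := by
  obtain ⟨a, ha⟩ := abs_mul_round_le_one_div (γ := β) h hN
  exact ⟨1, a, one_pos, by rw [Nat.cast_one]; exact one_le_pow₀ hK, ha⟩

/-- Only finitely many denominators v ≤ K^C compete, and each vβ stays at a positive distance from
the integers while the permitted error tends to 0. -/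
theorem eventually_not_nearRational {C d : ℕ} {β : ℝ} (hd : 1 ≤ d) (hβ : Irrational β) (K : ℝ) :
    ∀ᶠ k : ℕ in Filter.atTop, ¬ NearRational C d β K (2 ^ k) := by
  have hlim : Filter.Tendsto (fun k : ℕ => K ^ C / ((2 ^ k : ℕ) : ℝ) ^ d) Filter.atTop (nhds 0) := by
    refine Filter.Tendsto.const_div_atTop ?_ _
    refine (Filter.tendsto_pow_atTop (by omega : d ≠ 0)).comp ?_
    push_cast
    exact tendsto_pow_atTop_atTop_of_one_lt (by norm_num)
  have h1 : ∀ v ∈ Finset.Icc 1 ⌊K ^ C⌋₊, ∀ᶠ k : ℕ in Filter.atTop,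
      K ^ C / ((2 ^ k : ℕ) : ℝ) ^ d < |v * β - round (v * β)| := by
    intro v hv
    refine hlim.eventually (gt_mem_nhds (abs_pos.mpr ?_))
    have hv0 : v ≠ 0 := by have := (Finset.mem_Icc.mp hv).1; omega
    have hirr : Irrational (v * β) := hβ.natCast_mul hv0
    exact sub_ne_zero.mpr (hirr.ne_int _)
  filter_upwards [(Filter.eventually_all_finset _).mpr h1] with k hk
  rintro ⟨v, b, hv0, hv, hvb⟩
  have h2 := hk v (Finset.mem_Icc.mpr ⟨hv0, Nat.le_floor hv⟩)
  have h3 := round_le (v * β) b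
  linarith

/-- The symmetric sums of the modes, taken along a suitable sequence of scales, have summable
increments. -/
theorem exists_scales {e : ℕ} (he : 1 ≤ e) (α : ℕ → ℤ) (p : ℕ) {q : ℕ} (hq : 0 < q)
    (hB : phaseMultiplier e α p q ≠ 0) {θ : ℝ} (hθ : θ ∈ Set.Ioo (0 : ℝ) 1)
    (hirr : Irrational θ) : ∃ (X : ℕ → ℕ) (ε : ℕ → ℝ), Monotone X ∧
      Filter.Tendsto X Filter.atTop Filter.atTop ∧ (∀ i, 0 < X i) ∧ Summable ε ∧
      ∀ i x, ‖symmSum (modeValue e α p q θ x) (X i) (X (i + 1))‖ ≤ ε i := by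
  obtain ⟨C, c, hC, hc, hstage⟩ := exists_norm_symmSum_stage_le he α p hq hB
  set β := (phaseMultiplier e α p q : ℝ) * θ
  have hβ : Irrational β := hirr.intCast_mul hB
  have hex : ∀ i : ℕ, ∃ k₀, ∀ k ≥ k₀, ¬ NearRational C (e + 1) β (2 ^ (i + 1)) (2 ^ k) := fun i =>
    Filter.eventually_atTop.mp (eventually_not_nearRational (by omega) hβ _)
  classical
  set κ : ℕ → ℕ := fun i => Nat.find (hex i) with hκ
  have hspec : ∀ i, ∀ k ≥ κ i, ¬ NearRational C (e + 1) β (2 ^ (i + 1)) (2 ^ k) := fun i =>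
    Nat.find_spec (hex i)
  have hmono : Monotone κ := by
    refine monotone_nat_of_le_succ fun i => Nat.find_min' (hex i) fun k hk hnear => ?_
    exact hspec (i + 1) k hk (hnear.mono (by positivity)
      (pow_le_pow_right₀ (by norm_num) (by omega)))
  -- Denominator 1 is admissible while 2^(k(e+1)) ≤ (2^(i+1))^C, so κ i > k as soon as i ≥ k(e + 1);
  -- this uses C ≥ 1.
  have htend : Filter.Tendsto κ Filter.atTop Filter.atTop := by
    refine Filter.tendsto_atTop_atTop.mpr fun k => ⟨k * (e + 1), fun i hi => ?_⟩
    by_contra hlt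
    refine hspec i k (by omega) (nearRational_of_pow_le (one_le_pow₀ (by norm_num))
      Nat.one_le_two_pow ?_)
    push_cast
    rw [← pow_mul, ← pow_mul]
    refine pow_le_pow_right₀ (by norm_num) ?_
    exact hi.trans ((Nat.le_succ i).trans (Nat.le_mul_of_pos_right _ (by omega)))
  refine ⟨fun i => q * 2 ^ κ i, fun i => c * ((i : ℝ) + 2) / 2 ^ (i + 1), ?_, ?_, ?_, ?_, ?_⟩
  · exact fun i j hij => Nat.mul_le_mul_left q (Nat.pow_le_pow_right two_pos (hmono hij))
  · refine Filter.tendsto_atTop_mono (fun i => ?_) htend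
    exact (Nat.lt_two_pow_self.le).trans (Nat.le_mul_of_pos_left _ hq)
  · intro i; positivity
  · have h1 : Summable fun i : ℕ => (i : ℝ) ^ 1 * (1 / 2 : ℝ) ^ i :=
      summable_pow_mul_geometric_of_norm_lt_one 1 (by norm_num)
    have h2 : Summable fun i : ℕ => (1 / 2 : ℝ) ^ i := summable_geometric_two
    refine ((h1.mul_left (c / 2)).add (h2.mul_left c)).congr fun i => ?_
    rw [one_div, inv_pow, pow_one]
    field_simp
    ring
  · intro i x
    have h := hstage θ hθ (i + 1) (κ i) (κ (i + 1)) (by omega) (hmono (Nat.le_succ i)) (hspec i)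
      -- Minimality of κ (i + 1): non-approximability holds from there on, so it must fail at the
      -- scale just before.
      (fun hlt => by
        by_contra hnot
        have h1 : κ (i + 1) - 1 < κ (i + 1) := by omega
        refine Nat.find_min (hex (i + 1)) h1 fun k hk => ?_
        rcases eq_or_lt_of_le hk with rfl | hlt'
        · exact hnot
        · exact hspec (i + 1) k (by omega)) x
    refine h.trans (le_of_eq ?_)
    push_cast; ring

/-! ### Fourier modes as a Hilbert basis -/

/-- The Fourier mode `x ↦ exp (i j x)`. -/
noncomputable def fourierMode (j : ℤ) (x : ℝ) : ℂ := Complex.exp (Complex.I * j * x)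

theorem fourierMode_eq_unitExp (j : ℤ) (x : ℝ) :
    fourierMode j x = unitExp (j * (x / (2 * Real.pi))) := by
  rw [fourierMode, unitExp]
  congr 1
  have : (Real.pi : ℂ) ≠ 0 := by exact_mod_cast Real.pi_pos.ne'
  push_cast
  field_simp

@[simp] theorem norm_fourierMode (j : ℤ) (x : ℝ) : ‖fourierMode j x‖ = 1 := by
  rw [fourierMode_eq_unitExp, norm_unitExp]

theorem conj_fourierMode (j : ℤ) (x : ℝ) :
    (starRingEnd ℂ) (fourierMode j x) = fourierMode (-j) x := by
  rw [fourierMode, fourierMode, ← Complex.exp_conj]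
  congr 1
  simp

theorem fourierMode_add (j k : ℤ) (x : ℝ) :
    fourierMode (j + k) x = fourierMode j x * fourierMode k x := by
  rw [fourierMode, fourierMode, fourierMode, ← Complex.exp_add]
  congr 1; push_cast; ring

theorem fourierMode_add_right (j : ℤ) (x y : ℝ) :
    fourierMode j (x + y) = fourierMode j x * fourierMode j y := by
  rw [fourierMode, fourierMode, fourierMode, ← Complex.exp_add]
  congr 1; push_cast; ring

theorem fourierMode_zero_right (j : ℤ) : fourierMode j 0 = 1 := by simp [fourierMode]

theorem fourierMode_two_pi_mul (j k : ℤ) : fourierMode j (k * (2 * Real.pi)) = 1 := by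
  rw [fourierMode, Complex.exp_eq_one_iff]
  exact ⟨j * k, by push_cast; ring⟩

theorem fourierMode_two_pi (j : ℤ) : fourierMode j (2 * Real.pi) = 1 := by
  simpa using fourierMode_two_pi_mul j 1

theorem hasDerivAt_fourierMode (j : ℤ) (x : ℝ) :
    HasDerivAt (fourierMode j) (Complex.I * j * fourierMode j x) x := by
  have h1 : HasDerivAt (fun y : ℂ => Complex.exp (Complex.I * j * y))
      (Complex.exp (Complex.I * j * x) * (Complex.I * j * 1)) (x : ℂ) :=
    (((hasDerivAt_id (x : ℂ)).const_mul (Complex.I * j)).cexp)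
  refine h1.comp_ofReal.congr_deriv ?_
  change _ = Complex.I * j * Complex.exp (Complex.I * j * x)
  ring

theorem contDiff_fourierMode (j : ℤ) {n : WithTop ℕ∞} : ContDiff ℝ n (fourierMode j) := by
  unfold fourierMode
  exact ((contDiff_const (c := Complex.I * (j : ℂ))).mul Complex.ofRealCLM.contDiff).cexp

theorem continuous_fourierMode (j : ℤ) : Continuous (fourierMode j) :=
  (contDiff_fourierMode j (n := 0)).continuous

theorem iteratedDeriv_fourierMode (j : ℤ) (k : ℕ) :
    iteratedDeriv k (fourierMode j) = fun x => (Complex.I * j) ^ k * fourierMode j x := by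
  induction k with
  | zero => simp
  | succ k ih =>
    rw [iteratedDeriv_succ, ih]
    ext x
    rw [((hasDerivAt_fourierMode j x).const_mul _).deriv]
    ring

theorem isPeriodicTest_fourierMode (n : ℕ) (j : ℤ) : IsPeriodicTest n (fourierMode j) where
  contDiff := contDiff_fourierMode j
  boundary m _ := by
    rw [iteratedDeriv_fourierMode]
    simp only [fourierMode_zero_right, fourierMode_two_pi]

theorem diffOp_fourierMode (Q : ℝ[X]) (j : ℤ) (x : ℝ) :
    diffOp Q (fourierMode j) x = (Q.eval (j : ℝ) : ℝ) * fourierMode j x := by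
  rw [diffOp, Polynomial.eval_eq_sum, Polynomial.sum, Polynomial.sum]
  push_cast
  rw [Finset.sum_mul]
  refine Finset.sum_congr rfl fun k _ => ?_
  rw [iteratedDeriv_fourierMode, ← mul_assoc ((-Complex.I) ^ k), ← mul_pow]
  have : -Complex.I * (Complex.I * j) = j := by
    linear_combination (-(j : ℂ)) * Complex.I_mul_I
  rw [this]; ring

/-- The (unnormalised) Fourier coefficients `∫ f(x) exp (-i j x) dx` over a period. -/
noncomputable def modeCoeff (f : ℝ → ℂ) (j : ℤ) : ℂ :=
  ∫ x in Ioc 0 (2 * Real.pi), f x * (starRingEnd ℂ) (fourierMode j x)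

theorem modeCoeff_congr_ae {f g : ℝ → ℂ} (h : f =ᵐ[spaceMeasure] g) (j : ℤ) :
    modeCoeff f j = modeCoeff g j := by
  refine integral_congr_ae ?_
  filter_upwards [h] with x hx
  rw [hx]

theorem memLp_of_continuous {f : ℝ → ℂ} (hf : Continuous f) : MemLp f 2 spaceMeasure := by
  obtain ⟨M, hM⟩ := (isCompact_Icc (a := (0 : ℝ)) (b := 2 * Real.pi)).exists_bound_of_continuousOn
    hf.continuousOn
  refine MemLp.of_bound hf.aestronglyMeasurable M ?_
  filter_upwards [ae_restrict_mem measurableSet_Ioc] with x hx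
  exact hM x (Ioc_subset_Icc_self hx)

theorem setIntegral_fourierMode (j : ℤ) :
    ∫ x in Ioc 0 (2 * Real.pi), fourierMode j x = if j = 0 then (2 * Real.pi : ℂ) else 0 := by
  rw [← intervalIntegral.integral_of_le Real.two_pi_pos.le]
  split_ifs with h
  · simp [h, fourierMode]
  · have hj : Complex.I * (j : ℂ) ≠ 0 := mul_ne_zero Complex.I_ne_zero (by exact_mod_cast h)
    have h1 : ∫ x in (0 : ℝ)..2 * Real.pi, Complex.I * j * fourierMode j x = 0 := by
      rw [intervalIntegral.integral_eq_sub_of_hasDerivAt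
        (fun x _ => hasDerivAt_fourierMode j x)
        ((continuous_const.mul (continuous_fourierMode j)).intervalIntegrable _ _),
        fourierMode_two_pi, fourierMode_zero_right, sub_self]
    rw [intervalIntegral.integral_const_mul] at h1
    exact (mul_eq_zero.mp h1).resolve_left hj

theorem modeCoeff_fourierMode (k j : ℤ) :
    modeCoeff (fourierMode k) j = if k = j then (2 * Real.pi : ℂ) else 0 := by
  simp_rw [modeCoeff, conj_fourierMode, ← fourierMode_add]
  rw [setIntegral_fourierMode]
  simp only [← sub_eq_add_neg, sub_eq_zero]

/-- A Fourier mode as an element of `L²(0, 2π)`. -/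
noncomputable def modeLp (j : ℤ) : L2Space := (memLp_of_continuous (continuous_fourierMode j)).toLp

theorem coeFn_modeLp (j : ℤ) : modeLp j =ᵐ[spaceMeasure] fourierMode j := MemLp.coeFn_toLp _

theorem inner_eq_setIntegral (f g : L2Space) {φ : ℝ → ℂ} (hφ : f =ᵐ[spaceMeasure] φ) :
    inner ℂ f g = ∫ x in Ioc 0 (2 * Real.pi), g x * (starRingEnd ℂ) (φ x) := by
  rw [MeasureTheory.L2.inner_def]
  refine integral_congr_ae ?_
  filter_upwards [hφ] with x hx
  rw [hx, RCLike.inner_apply]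

theorem inner_modeLp (j : ℤ) (f : L2Space) : inner ℂ (modeLp j) f = modeCoeff f j :=
  inner_eq_setIntegral _ _ (coeFn_modeLp j)

theorem sqrt_two_pi_ne_zero : ((Real.sqrt (2 * Real.pi) : ℝ) : ℂ) ≠ 0 := by
  exact_mod_cast (Real.sqrt_pos.mpr Real.two_pi_pos).ne'

theorem orthonormal_modeLp :
    Orthonormal ℂ (fun j => ((Real.sqrt (2 * Real.pi) : ℝ) : ℂ)⁻¹ • modeLp j) := by
  rw [orthonormal_iff_ite]
  intro j k
  rw [inner_smul_left, inner_smul_right, inner_modeLp, modeCoeff_congr_ae (coeFn_modeLp k),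
    modeCoeff_fourierMode, map_inv₀, Complex.conj_ofReal]
  have h2 : ((Real.sqrt (2 * Real.pi) : ℝ) : ℂ) * (Real.sqrt (2 * Real.pi) : ℝ) =
      2 * Real.pi := by
    rw [← Complex.ofReal_mul, Real.mul_self_sqrt Real.two_pi_pos.le]; push_cast; ring
  by_cases h : j = k
  · rw [if_pos h, if_pos h.symm, ← h2]
    have := sqrt_two_pi_ne_zero
    field_simp
  · rw [if_neg h, if_neg (Ne.symm h), mul_zero, mul_zero]

theorem fourierCoeffOn_eq_modeCoeff (f : ℝ → ℂ) (j : ℤ) :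
    fourierCoeffOn Real.two_pi_pos f j = (1 / (2 * Real.pi) : ℝ) • modeCoeff f j := by
  rw [fourierCoeffOn_eq_integral, sub_zero, modeCoeff,
    intervalIntegral.integral_of_le Real.two_pi_pos.le]
  congr 1
  refine integral_congr_ae (Filter.Eventually.of_forall fun x => ?_)
  dsimp only
  rw [conj_fourierMode, smul_eq_mul, mul_comm, fourier_coe_apply, fourierMode]
  congr 2
  have : (Real.pi : ℂ) ≠ 0 := by exact_mod_cast Real.pi_pos.ne'
  push_cast
  field_simp

/-- Completeness of the modes, read off from Parseval's identity. -/
theorem eq_zero_of_modeCoeff_eq_zero {f : L2Space} (hf : ∀ j, modeCoeff f j = 0) : f = 0 := by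
  have h1 := hasSum_sq_fourierCoeffOn Real.two_pi_pos (Lp.memLp f)
  simp_rw [fourierCoeffOn_eq_modeCoeff, hf, smul_zero, norm_zero, zero_pow two_ne_zero] at h1
  have h2 := h1.unique hasSum_zero
  rw [sub_zero, smul_eq_mul, mul_eq_zero, or_iff_right (by positivity),
    intervalIntegral.integral_of_le Real.two_pi_pos.le,
    integral_eq_zero_iff_of_nonneg (fun x => by positivity)
      ((Lp.memLp f).integrable_norm_pow two_ne_zero)] at h2
  refine (Lp.eq_zero_iff_ae_eq_zero).mpr ?_
  filter_upwards [h2] with x hx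
  simpa using hx

/-- The orthonormal Fourier basis of `L²(0, 2π)`. -/
noncomputable def modeBasis : HilbertBasis ℤ ℂ L2Space :=
  HilbertBasis.mkOfOrthogonalEqBot orthonormal_modeLp (by
    rw [Submodule.eq_bot_iff]
    intro f hf
    refine eq_zero_of_modeCoeff_eq_zero fun j => ?_
    have h1 := (Submodule.mem_orthogonal _ f).mp hf _ (Submodule.subset_span (mem_range_self j))
    rw [inner_smul_left, inner_modeLp] at h1
    refine (mul_eq_zero.mp h1).resolve_left ?_
    rw [map_inv₀, Complex.conj_ofReal]
    exact inv_ne_zero sqrt_two_pi_ne_zero)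

theorem modeBasis_apply (j : ℤ) :
    modeBasis j = ((Real.sqrt (2 * Real.pi) : ℝ) : ℂ)⁻¹ • modeLp j := by
  rw [modeBasis, HilbertBasis.coe_mkOfOrthogonalEqBot]

theorem modeBasis_repr (f : L2Space) (j : ℤ) :
    modeBasis.repr f j = ((Real.sqrt (2 * Real.pi) : ℝ) : ℂ)⁻¹ * modeCoeff f j := by
  rw [HilbertBasis.repr_apply_apply, modeBasis_apply, inner_smul_left, inner_modeLp, map_inv₀,
    Complex.conj_ofReal]

theorem L2Space.ext_modeCoeff {f g : L2Space} (h : ∀ j, modeCoeff f j = modeCoeff g j) : f = g := by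
  refine modeBasis.repr.injective (lp.ext ?_)
  funext j
  rw [modeBasis_repr, modeBasis_repr, h]

/-! ### Weak solutions: existence and uniqueness -/

theorem modeCoeff_iteratedDeriv_succ {n : ℕ} {φ : ℝ → ℂ} (hφ : IsPeriodicTest n φ) {k : ℕ}
    (hk : k < n) (j : ℤ) :
    modeCoeff (iteratedDeriv (k + 1) φ) j = Complex.I * j * modeCoeff (iteratedDeriv k φ) j := by
  have hd : ∀ x, HasDerivAt (iteratedDeriv k φ) (iteratedDeriv (k + 1) φ x) x := by
    intro x
    rw [iteratedDeriv_succ]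
    exact (hφ.contDiff.differentiable_iteratedDeriv k (by exact_mod_cast hk) x).hasDerivAt
  have hc : Continuous (iteratedDeriv (k + 1) φ) :=
    hφ.contDiff.continuous_iteratedDeriv (k + 1) (by exact_mod_cast hk)
  have h1 := intervalIntegral.integral_mul_deriv_eq_deriv_mul (a := 0) (b := 2 * Real.pi)
    (fun x _ => hasDerivAt_fourierMode (-j) x) (fun x _ => hd x)
    ((continuous_const.mul (continuous_fourierMode (-j))).intervalIntegrable _ _)
    (hc.intervalIntegrable _ _)
  rw [fourierMode_two_pi, fourierMode_zero_right, hφ.boundary k hk, sub_self, zero_sub] at h1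
  rw [modeCoeff, modeCoeff, ← intervalIntegral.integral_of_le Real.two_pi_pos.le,
    ← intervalIntegral.integral_of_le Real.two_pi_pos.le, ← intervalIntegral.integral_const_mul]
  simp_rw [conj_fourierMode]
  have e1 : ∀ x, iteratedDeriv (k + 1) φ x * fourierMode (-j) x =
      fourierMode (-j) x * iteratedDeriv (k + 1) φ x := fun x => mul_comm _ _
  simp_rw [e1]
  rw [h1, ← intervalIntegral.integral_neg]
  congr 1
  ext x
  push_cast; ring

theorem modeCoeff_iteratedDeriv {n : ℕ} {φ : ℝ → ℂ} (hφ : IsPeriodicTest n φ) {k : ℕ}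
    (hk : k ≤ n) (j : ℤ) :
    modeCoeff (iteratedDeriv k φ) j = (Complex.I * j) ^ k * modeCoeff φ j := by
  induction k with
  | zero => simp
  | succ k ih =>
    rw [modeCoeff_iteratedDeriv_succ hφ hk, ih (by omega)]; ring

theorem continuous_diffOp {n : ℕ} {φ : ℝ → ℂ} (hφ : IsPeriodicTest n φ) {Q : ℝ[X]}
    (hQ : Q.natDegree ≤ n) : Continuous (diffOp Q φ) := by
  unfold diffOp
  simp only [Polynomial.sum]
  refine continuous_finsetSum _ fun k hk => ?_
  have hkn : k ≤ n := (Polynomial.le_natDegree_of_mem_supp k hk).trans hQ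
  exact continuous_const.mul (continuous_const.mul
    (hφ.contDiff.continuous_iteratedDeriv k (by exact_mod_cast hkn)))

theorem modeCoeff_diffOp {n : ℕ} {φ : ℝ → ℂ} (hφ : IsPeriodicTest n φ) {Q : ℝ[X]}
    (hQ : Q.natDegree ≤ n) (j : ℤ) :
    modeCoeff (diffOp Q φ) j = (Q.eval (j : ℝ) : ℝ) * modeCoeff φ j := by
  have h1 : modeCoeff (diffOp Q φ) j = ∑ k ∈ Q.support,
      (Q.coeff k : ℂ) * ((-Complex.I) ^ k * modeCoeff (iteratedDeriv k φ) j) := by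
    simp only [modeCoeff, diffOp, Polynomial.sum, Finset.sum_mul]
    rw [integral_finsetSum]
    · refine Finset.sum_congr rfl fun k _ => ?_
      rw [← integral_const_mul, ← integral_const_mul]
      congr 1
      ext x
      ring
    · intro k hk
      have hkn : k ≤ n := (Polynomial.le_natDegree_of_mem_supp k hk).trans hQ
      have hc : Continuous fun x => (Q.coeff k : ℂ) * ((-Complex.I) ^ k * iteratedDeriv k φ x) *
          (starRingEnd ℂ) (fourierMode j x) :=
        (continuous_const.mul (continuous_const.mul
          (hφ.contDiff.continuous_iteratedDeriv k (by exact_mod_cast hkn)))).mul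
          (Complex.continuous_conj.comp (continuous_fourierMode j))
      exact (hc.integrableOn_Icc (a := 0) (b := 2 * Real.pi)).mono_set Ioc_subset_Icc_self
  rw [h1, Polynomial.eval_eq_sum, Polynomial.sum]
  push_cast
  rw [Finset.sum_mul]
  refine Finset.sum_congr rfl fun k hk => ?_
  have hkn : k ≤ n := (Polynomial.le_natDegree_of_mem_supp k hk).trans hQ
  rw [modeCoeff_iteratedDeriv hφ hkn, ← mul_assoc ((-Complex.I) ^ k), ← mul_pow]
  have : -Complex.I * (Complex.I * j) = j := by
    linear_combination (-(j : ℂ)) * Complex.I_mul_I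
  rw [this]; ring

/-- The phase factor of the `j`-th mode at time `t`. -/
noncomputable def phaseFactor (Q : ℝ[X]) (t : ℝ) (j : ℤ) : ℂ :=
  Complex.exp (-(Complex.I * (Q.eval (j : ℝ) : ℝ)) * t)

@[simp] theorem norm_phaseFactor (Q : ℝ[X]) (t : ℝ) (j : ℤ) : ‖phaseFactor Q t j‖ = 1 := by
  have : -(Complex.I * (Q.eval (j : ℝ) : ℝ)) * t = ((-(Q.eval (j : ℝ) * t) : ℝ) : ℂ) * Complex.I := by
    push_cast; ring
  rw [phaseFactor, this, Complex.norm_exp_ofReal_mul_I]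

theorem hasDerivAt_phaseFactor (Q : ℝ[X]) (t : ℝ) (j : ℤ) :
    HasDerivAt (fun s => phaseFactor Q s j)
      (-(Complex.I * (Q.eval (j : ℝ) : ℝ)) * phaseFactor Q t j) t := by
  have h1 : HasDerivAt (fun y : ℂ => Complex.exp (-(Complex.I * (Q.eval (j : ℝ) : ℝ)) * y))
      (Complex.exp (-(Complex.I * (Q.eval (j : ℝ) : ℝ)) * t) *
        (-(Complex.I * (Q.eval (j : ℝ) : ℝ)) * 1)) (t : ℂ) :=
    (((hasDerivAt_id (t : ℂ)).const_mul _).cexp)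
  refine h1.comp_ofReal.congr_deriv ?_
  change _ = _ * Complex.exp (-(Complex.I * (Q.eval (j : ℝ) : ℝ)) * t)
  ring

/-- The coefficient sequence of the solution at time `t`. -/
noncomputable def evolvedCoeff (Q : ℝ[X]) (z₀ : L2Space) (t : ℝ) : lp (fun _ : ℤ => ℂ) 2 :=
  ⟨fun j => phaseFactor Q t j * modeBasis.repr z₀ j, by
    have h := (memℓp_gen_iff (p := 2) (by norm_num)).mp (lp.memℓp (modeBasis.repr z₀))
    refine (memℓp_gen_iff (p := 2) (by norm_num)).mpr (h.congr fun j => ?_)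
    rw [norm_mul, norm_phaseFactor, one_mul]⟩

theorem continuous_evolvedCoeff (Q : ℝ[X]) (z₀ : L2Space) : Continuous (evolvedCoeff Q z₀) := by
  rw [continuous_iff_continuousAt]
  intro t
  set a := modeBasis.repr z₀ with ha
  have hsum : Summable fun j => ‖a j‖ ^ 2 := by
    have := (memℓp_gen_iff (p := 2) (by norm_num)).mp (lp.memℓp a)
    simpa using this
  rw [ContinuousAt, tendsto_iff_norm_sub_tendsto_zero]
  have h1 : ∀ s, ‖evolvedCoeff Q z₀ s - evolvedCoeff Q z₀ t‖ =
      Real.sqrt (∑' j, ‖(phaseFactor Q s j - phaseFactor Q t j) * a j‖ ^ 2) := by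
    intro s
    rw [lp.norm_eq_tsum_rpow (by norm_num), ENNReal.toReal_ofNat, Real.sqrt_eq_rpow]
    congr 1
    refine tsum_congr fun j => ?_
    rw [Real.rpow_two, sub_mul]
    rfl
  simp_rw [h1]
  rw [← Real.sqrt_zero]
  refine (Real.continuous_sqrt.tendsto 0).comp ?_
  have h0 : (0 : ℝ) = ∑' j : ℤ, (0 : ℝ) := tsum_zero.symm
  rw [h0]
  refine tendsto_tsum_of_dominated_convergence (bound := fun j => 4 * ‖a j‖ ^ 2)
    (hsum.mul_left 4) (fun j => ?_) (Filter.Eventually.of_forall fun s j => ?_)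
  · have hc : Continuous fun s => ‖(phaseFactor Q s j - phaseFactor Q t j) * a j‖ ^ 2 := by
      have : Continuous fun s => phaseFactor Q s j :=
        continuous_iff_continuousAt.mpr fun s => (hasDerivAt_phaseFactor Q s j).continuousAt
      fun_prop
    have := hc.tendsto t
    simpa using this
  · rw [Real.norm_of_nonneg (by positivity), norm_mul, mul_pow]
    refine mul_le_mul_of_nonneg_right ?_ (by positivity)
    have h2 : ‖phaseFactor Q s j - phaseFactor Q t j‖ ≤ 2 :=
      (norm_sub_le _ _).trans (by rw [norm_phaseFactor, norm_phaseFactor]; norm_num)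
    nlinarith [norm_nonneg (phaseFactor Q s j - phaseFactor Q t j)]

/-- The solution of the periodic problem with initial value `z₀`. -/
noncomputable def evolve (Q : ℝ[X]) (z₀ : L2Space) (t : ℝ) : L2Space :=
  modeBasis.repr.symm (evolvedCoeff Q z₀ t)

theorem repr_evolve (Q : ℝ[X]) (z₀ : L2Space) (t : ℝ) (j : ℤ) :
    modeBasis.repr (evolve Q z₀ t) j = phaseFactor Q t j * modeBasis.repr z₀ j := by
  rw [evolve, LinearIsometryEquiv.apply_symm_apply]; rfl

theorem modeCoeff_evolve (Q : ℝ[X]) (z₀ : L2Space) (t : ℝ) (j : ℤ) :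
    modeCoeff (evolve Q z₀ t) j = phaseFactor Q t j * modeCoeff z₀ j := by
  have h := repr_evolve Q z₀ t j
  rw [modeBasis_repr, modeBasis_repr, mul_left_comm] at h
  exact mul_left_cancel₀ (inv_ne_zero sqrt_two_pi_ne_zero) h

theorem hasSum_setIntegral_mul_conj {φ : ℝ → ℂ} (hφ : Continuous φ) (f : L2Space) :
    HasSum (fun j => ((2 * Real.pi : ℝ) : ℂ)⁻¹ * ((starRingEnd ℂ) (modeCoeff φ j) * modeCoeff f j))
      (∫ x in Ioc 0 (2 * Real.pi), f x * (starRingEnd ℂ) (φ x)) := by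
  have hco := (memLp_of_continuous hφ).coeFn_toLp
  have h1 := modeBasis.hasSum_inner_mul_inner (memLp_of_continuous hφ).toLp f
  rw [inner_eq_setIntegral _ f hco] at h1
  refine h1.congr_fun ?_ |> id
  intro j
  rw [← inner_conj_symm, ← HilbertBasis.repr_apply_apply, ← HilbertBasis.repr_apply_apply,
    modeBasis_repr, modeBasis_repr, modeCoeff_congr_ae hco, map_mul, map_inv₀, Complex.conj_ofReal]
  have h2 : ((2 * Real.pi : ℝ) : ℂ) =
      ((Real.sqrt (2 * Real.pi) : ℝ) : ℂ) * (Real.sqrt (2 * Real.pi) : ℝ) := by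
    rw [← Complex.ofReal_mul, Real.mul_self_sqrt Real.two_pi_pos.le]
  rw [h2, mul_inv]
  ring

theorem setIntegral_evolve_eq_tsum (Q : ℝ[X]) (z₀ : L2Space) {φ : ℝ → ℂ} (hφ : Continuous φ)
    (t : ℝ) : HasSum (fun j => ((2 * Real.pi : ℝ) : ℂ)⁻¹ *
      ((starRingEnd ℂ) (modeCoeff φ j) * (phaseFactor Q t j * modeCoeff z₀ j)))
      (∫ x in Ioc 0 (2 * Real.pi), evolve Q z₀ t x * (starRingEnd ℂ) (φ x)) := by
  have h := hasSum_setIntegral_mul_conj hφ (evolve Q z₀ t)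
  simp_rw [modeCoeff_evolve] at h
  exact h

theorem hasDerivAt_tsum_phaseFactor (Q : ℝ[X]) {c : ℤ → ℂ} (hc : Summable c)
    (hQc : Summable fun j : ℤ => ‖((Q.eval (j : ℝ) : ℝ) : ℂ) * c j‖) (t : ℝ) :
    HasDerivAt (fun s => ∑' j, phaseFactor Q s j * c j)
      (∑' j : ℤ, -(Complex.I * (Q.eval (j : ℝ) : ℝ)) * phaseFactor Q t j * c j) t := by
  refine hasDerivAt_tsum hQc
    (fun j s => (hasDerivAt_phaseFactor Q s j).mul_const _) (fun j s => le_of_eq ?_) (y₀ := t) ?_ t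
  · rw [norm_mul, norm_mul, norm_neg, norm_mul, Complex.norm_I, norm_phaseFactor, norm_mul, mul_one,
      one_mul]
  · refine Summable.of_norm (hc.norm.congr fun j => ?_)
    rw [norm_mul, norm_phaseFactor, one_mul]

/-- The coefficients of `diffOp Q φ` are Q(j) times those of φ, and they are square summable because
`diffOp Q φ` is continuous. Paired with those of z₀ they are absolutely summable, uniformly in time,
so the series may be differentiated termwise with no smoothness of φ beyond C^n. -/
theorem hasDerivAt_setIntegral_evolve {n : ℕ} {Q : ℝ[X]} (hQ : Q.natDegree ≤ n) (z₀ : L2Space)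
    {φ : ℝ → ℂ} (hφ : IsPeriodicTest n φ) (t : ℝ) :
    HasDerivAt (fun s => ∫ x in Ioc 0 (2 * Real.pi), evolve Q z₀ s x * (starRingEnd ℂ) (φ x))
      (∫ x in Ioc 0 (2 * Real.pi),
        evolve Q z₀ t x * (starRingEnd ℂ) (Complex.I * diffOp Q φ x)) t := by
  have hψc : Continuous (diffOp Q φ) := continuous_diffOp hφ hQ
  have hcoef := modeCoeff_diffOp hφ hQ
  set c : ℤ → ℂ := fun j => ((2 * Real.pi : ℝ) : ℂ)⁻¹ *
    ((starRingEnd ℂ) (modeCoeff φ j) * modeCoeff z₀ j) with hc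
  have h1 : (fun s => ∫ x in Ioc 0 (2 * Real.pi), evolve Q z₀ s x * (starRingEnd ℂ) (φ x)) =
      fun s => ∑' j, phaseFactor Q s j * c j := by
    funext s
    rw [← (setIntegral_evolve_eq_tsum Q z₀ hφ.contDiff.continuous s).tsum_eq]
    refine tsum_congr fun j => ?_
    rw [hc]; ring
  have h2 : ∫ x in Ioc 0 (2 * Real.pi),
      evolve Q z₀ t x * (starRingEnd ℂ) (Complex.I * diffOp Q φ x) =
      ∑' j : ℤ, -(Complex.I * (Q.eval (j : ℝ) : ℝ)) * phaseFactor Q t j * c j := by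
    have e1 : ∀ x, evolve Q z₀ t x * (starRingEnd ℂ) (Complex.I * diffOp Q φ x) =
        -Complex.I * (evolve Q z₀ t x * (starRingEnd ℂ) (diffOp Q φ x)) := by
      intro x; rw [map_mul, Complex.conj_I]; ring
    simp_rw [e1]
    rw [integral_const_mul, ← (setIntegral_evolve_eq_tsum Q z₀ hψc t).tsum_eq, ← tsum_mul_left]
    refine tsum_congr fun j => ?_
    rw [hcoef, map_mul, Complex.conj_ofReal, hc]
    ring
  rw [h1, h2]
  refine hasDerivAt_tsum_phaseFactor Q
    (hasSum_setIntegral_mul_conj hφ.contDiff.continuous z₀).summable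
    ((hasSum_setIntegral_mul_conj hψc z₀).summable.norm.congr fun j => ?_) t
  rw [hcoef, map_mul, Complex.conj_ofReal]
  congr 1; ring

theorem isPeriodicSolution_evolve {n : ℕ} {Q : ℝ[X]} (hQ : Q.natDegree ≤ n) (z₀ : L2Space) :
    IsPeriodicSolution n Q z₀ (evolve Q z₀) where
  continuousOn :=
    (modeBasis.repr.symm.continuous.comp (continuous_evolvedCoeff Q z₀)).continuousOn
  initial := by
    refine L2Space.ext_modeCoeff fun j => ?_
    rw [modeCoeff_evolve, phaseFactor]
    simp
  weak _ hφ t _ := (hasDerivAt_setIntegral_evolve hQ z₀ hφ t).hasDerivWithinAt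

/-- The Fourier coefficients of a solution are determined by those of the initial value. -/
theorem IsPeriodicSolution.modeCoeff_eq {n : ℕ} {Q : ℝ[X]} {z₀ : L2Space} {w : ℝ → L2Space}
    (hw : IsPeriodicSolution n Q z₀ w) {t : ℝ} (ht : 0 ≤ t) (j : ℤ) :
    modeCoeff (w t) j = phaseFactor Q t j * modeCoeff z₀ j := by
  set a : ℂ := Complex.I * (Q.eval (j : ℝ) : ℝ) with ha
  have hder : ∀ s, 0 ≤ s → HasDerivWithinAt (fun s => modeCoeff (w s) j)
      (-a * modeCoeff (w s) j) (Ici 0) s := by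
    intro s hs
    -- The mode is itself a test function and an eigenfunction of the operator, so the weak equation
    -- becomes a scalar linear ODE, solved by an integrating factor.
    refine (hw.weak _ (isPeriodicTest_fourierMode n j) s hs).congr_deriv ?_
    rw [modeCoeff, ← integral_const_mul]
    congr 1
    ext x
    rw [diffOp_fourierMode, map_mul, map_mul, Complex.conj_I, Complex.conj_ofReal, ha]
    ring
  have hexp : ∀ s : ℝ, HasDerivAt (fun s : ℝ => Complex.exp (a * s)) (a * Complex.exp (a * s)) s := by
    intro s
    have h1 : HasDerivAt (fun y : ℂ => Complex.exp (a * y))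
        (Complex.exp (a * s) * (a * 1)) (s : ℂ) := (((hasDerivAt_id (s : ℂ)).const_mul a).cexp)
    exact h1.comp_ofReal.congr_deriv (by ring)
  have hprod : ∀ s, 0 ≤ s → HasDerivWithinAt
      (fun s : ℝ => Complex.exp (a * s) * modeCoeff (w s) j) 0 (Ici 0) s := by
    intro s hs
    exact ((hexp s).hasDerivWithinAt.mul (hder s hs)).congr_deriv (by ring)
  have hconst := constant_of_has_deriv_right_zero (a := 0) (b := t)
    (fun s hs => ((hprod s hs.1).continuousWithinAt).mono Icc_subset_Ici_self)
    (fun s hs => (hprod s hs.1).mono (Ici_subset_Ici.mpr hs.1)) t ⟨ht, le_rfl⟩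
  rw [hw.initial] at hconst
  simp only [Complex.ofReal_zero, mul_zero, Complex.exp_zero, one_mul] at hconst
  rw [← hconst, phaseFactor, ← mul_assoc, ← Complex.exp_add, ← ha]
  have : -a * t + a * t = 0 := by ring
  rw [this, Complex.exp_zero, one_mul]

/-! ### Periodic translation and rational θ -/

theorem periodic_periodicExt (f : ℝ → ℂ) : Function.Periodic (periodicExt f) (2 * Real.pi) := by
  intro x
  rw [periodicExt, periodicExt, toIcoMod_add_right]

theorem periodicExt_of_mem {f : ℝ → ℂ} {x : ℝ} (hx : x ∈ Ico 0 (2 * Real.pi)) :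
    periodicExt f x = f x := by
  rw [periodicExt, (toIcoMod_eq_self Real.two_pi_pos).mpr (by simpa using hx)]

theorem periodicExt_ae_eq (f : ℝ → ℂ) : periodicExt f =ᵐ[spaceMeasure] f := by
  rw [spaceMeasure, ← restrict_Ioo_eq_restrict_Ioc]
  filter_upwards [ae_restrict_mem measurableSet_Ioo] with x hx
  exact periodicExt_of_mem (Ioo_subset_Ico_self hx)

theorem modeCoeff_periodicTranslate (f : ℝ → ℂ) (s : ℝ) (j : ℤ) :
    modeCoeff (periodicTranslate s f) j = fourierMode (-j) s * modeCoeff f j := by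
  set F : ℝ → ℂ := fun y => periodicExt f y * fourierMode (-j) y with hF
  have hper : Function.Periodic F (2 * Real.pi) := by
    intro x
    simp only [hF]
    rw [periodic_periodicExt f x, fourierMode_add_right, fourierMode_two_pi, mul_one]
  have h1 : modeCoeff (periodicTranslate s f) j =
      ∫ x in (0 : ℝ)..2 * Real.pi, fourierMode (-j) s * F (x - s) := by
    rw [modeCoeff, intervalIntegral.integral_of_le Real.two_pi_pos.le]
    congr 1
    ext x
    simp only [hF]
    rw [conj_fourierMode, periodicTranslate, mul_left_comm, ← fourierMode_add_right,
      add_sub_cancel]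
  rw [h1, intervalIntegral.integral_const_mul, intervalIntegral.integral_comp_sub_right]
  have h2 := hper.intervalIntegral_add_eq (0 - s) 0
  rw [zero_add, show 0 - s + 2 * Real.pi = 2 * Real.pi - s by ring] at h2
  rw [h2, intervalIntegral.integral_of_le Real.two_pi_pos.le,
    modeCoeff_congr_ae (periodicExt_ae_eq f).symm, modeCoeff]
  simp_rw [conj_fourierMode, hF]

/-- Translation preserves the measure of the circle. The lift through (0, 2π] and the extension from
[0, 2π) disagree only on the countable set s + 2πℤ. -/
theorem memLp_periodicTranslate {f : ℝ → ℂ} (hf : MemLp f 2 spaceMeasure) (s : ℝ) :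
    MemLp (periodicTranslate s f) 2 spaceMeasure := by
  have : Fact (0 < 2 * Real.pi) := ⟨Real.two_pi_pos⟩
  have h0 : MemLp f 2 (volume.restrict (Ioc 0 (0 + 2 * Real.pi))) := by rwa [zero_add]
  have h1 := h0.memLp_liftIoc
  have h2 := (h1.comp_measurePreserving
    (measurePreserving_sub_right volume (s : AddCircle (2 * Real.pi)))).comp_measurePreserving
    (AddCircle.measurePreserving_mk (2 * Real.pi) 0)
  rw [zero_add] at h2
  refine h2.ae_eq ?_
  have hcount : {x : ℝ | (0 : ℝ) ≡ x - s [PMOD (2 * Real.pi)]}.Countable := by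
    refine (countable_range fun z : ℤ => s + z * (2 * Real.pi)).mono ?_
    intro x hx
    obtain ⟨z, hz⟩ := AddCommGroup.modEq_iff_eq_add_zsmul.mp hx
    refine ⟨z, ?_⟩
    rw [zsmul_eq_mul] at hz
    linarith
  filter_upwards [ae_restrict_of_ae (hcount.ae_notMem volume)] with x hx
  have h3 := (AddCommGroup.not_modEq_iff_toIcoMod_eq_toIocMod Real.two_pi_pos).mp hx
  rw [periodicTranslate, periodicExt, h3]
  simp only [Function.comp_apply, AddCircle.liftIoc]
  rfl

theorem integrable_mul_conj_fourierMode {f : ℝ → ℂ} (hf : Integrable f spaceMeasure) (j : ℤ) :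
    Integrable (fun x => f x * (starRingEnd ℂ) (fourierMode j x)) spaceMeasure := by
  refine hf.mul_bdd (c := 1)
    (Complex.continuous_conj.comp (continuous_fourierMode j)).aestronglyMeasurable
    (Filter.Eventually.of_forall fun x => ?_)
  rw [RCLike.norm_conj, norm_fourierMode]

theorem phaseFactor_rational_time (e : ℕ) (α : ℕ → ℤ) (p q : ℕ) (θ : ℝ) (j : ℤ) :
    phaseFactor (polyA (e + 2) α θ) (2 * Real.pi * ((p : ℝ) / (q : ℝ))) j =
      unitExp (modePhase e α p q θ j) := by
  rw [phaseFactor, unitExp, modePhase]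
  congr 1
  push_cast; ring

/-- For rational θ the multiplier has period V in j. Its discrete Fourier expansion writes it as a
combination of e(jl/V), and multiplication of coefficients by e(jl/V) is translation by -2πl/V. -/
theorem exists_translates_of_rational (e : ℕ) (α : ℕ → ℤ) (p : ℕ) {q : ℕ} (hq : 0 < q) {θ : ℝ}
    (hθ : θ ∈ Set.range ((↑) : ℚ → ℝ)) :
    ∃ (N : ℕ) (c : Fin N → ℂ) (s : Fin N → ℝ), ∀ z₀ z : L2Space,
      (∀ j, modeCoeff z j = unitExp (modePhase e α p q θ j) * modeCoeff z₀ j) →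
      (z : ℝ → ℂ) =ᵐ[spaceMeasure] fun x => ∑ j, c j * periodicTranslate (s j) z₀ x := by
  obtain ⟨r, rfl⟩ := hθ
  have hr : (r : ℝ) = (r.num : ℝ) / (r.den : ℝ) := by exact_mod_cast (Rat.num_div_den r).symm
  set V : ℕ := q * r.den ^ (e + 2) with hV
  have hV0 : 0 < V := Nat.mul_pos hq (pow_pos r.den_pos _)
  set g : ℤ → ℂ := fun j => unitExp (modePhase e α p q r j) with hg
  have hper : ∀ j, g (j + V) = g j := by
    intro j
    obtain ⟨k, hk⟩ := modePhase_add_period α p e hq r.num r.den_pos j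
    simp only [hg]
    rw [hr, hV, hk, unitExp_add_intCast]
  obtain ⟨s, hs⟩ : ∃ s : ℕ → ℝ, ∀ l, s l = -(2 * Real.pi * (l / V : ℝ)) := ⟨_, fun _ => rfl⟩
  refine ⟨V, fun l => periodicCoeff g V l, fun l => s l, fun z₀ z hz => ?_⟩
  have hT : ∀ l : Fin V, MemLp (periodicTranslate (s l) z₀) 2 spaceMeasure := fun l => memLp_periodicTranslate (Lp.memLp z₀) _
  set F : ℝ → ℂ := fun x => ∑ l : Fin V,
    periodicCoeff g V l * periodicTranslate (s l) z₀ x with hF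
  have hFm : MemLp F 2 spaceMeasure := memLp_finsetSum _ fun l _ => (hT l).const_mul _
  have hz' : z = hFm.toLp := by
    refine L2Space.ext_modeCoeff fun j => ?_
    rw [hz, modeCoeff_congr_ae hFm.coeFn_toLp]
    have h1 : modeCoeff F j = ∑ l : Fin V, periodicCoeff g V l *
        modeCoeff (periodicTranslate (s l) z₀) j := by
      simp only [modeCoeff, hF, Finset.sum_mul, mul_assoc]
      rw [integral_finsetSum]
      · simp_rw [integral_const_mul]
      · intro l _
        exact (integrable_mul_conj_fourierMode ((hT l).integrable one_le_two) j).const_mul _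
    have h2 : ∀ l : ℕ, fourierMode (-j) (s l) =
        unitExp (j * (l / V : ℝ)) := by
      intro l
      rw [fourierMode_eq_unitExp, hs]
      congr 1
      have := Real.pi_pos.ne'
      push_cast
      field_simp
    rw [h1]
    simp_rw [modeCoeff_periodicTranslate, h2, ← mul_assoc]
    rw [← Finset.sum_mul]
    congr 1
    have h3 := eq_sum_periodicCoeff hV0 hper j
    rw [Finset.sum_range] at h3
    exact h3
  rw [hz']
  exact hFm.coeFn_toLp

/-! ### Bounded variation and continuity of the limit -/

/-- Integration by parts against a function of bounded variation, in the form of a bound. -/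
theorem norm_integral_mul_deriv_le_of_variation {a b : ℝ} (hab : a ≤ b) {g Φ Φ' : ℝ → ℂ}
    {V : ℝ → ℝ} {S : ℝ} (hg : IntervalIntegrable g volume a b)
    (hV : ∀ x ∈ Icc a b, ∀ y ∈ Icc a b, x ≤ y → ‖g y - g x‖ ≤ V y - V x)
    (hΦ : ∀ x, HasDerivAt Φ (Φ' x) x) (hΦ' : Continuous Φ') (hS : ∀ x, ‖Φ x‖ ≤ S) :
    ‖∫ x in a..b, g x * Φ' x‖ ≤ (‖g a‖ + ‖g b‖ + (V b - V a)) * S := by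
  obtain ⟨M, hM⟩ := (isCompact_Icc (a := a) (b := b)).exists_bound_of_continuousOn
    hΦ'.continuousOn
  have hM0 : 0 ≤ M := (norm_nonneg _).trans (hM a (left_mem_Icc.mpr hab))
  have hS0 : 0 ≤ S := (norm_nonneg _).trans (hS a)
  set W := V b - V a with hW
  have key : ∀ m : ℕ, ‖∫ x in a..b, g x * Φ' x‖ ≤
      (‖g a‖ + ‖g b‖ + W) * S + W * M * (b - a) / (m + 1) := by
    intro m
    set h : ℝ := (b - a) / (m + 1) with hh
    have hm0 : (0 : ℝ) < m + 1 := by positivity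
    have hh0 : 0 ≤ h := div_nonneg (by linarith) hm0.le
    set y : ℕ → ℝ := fun k => a + k * h with hy
    have hy0 : y 0 = a := by simp [hy]
    have hyn : y (m + 1) = b := by
      simp only [hy, hh]; push_cast; field_simp; ring
    have hstep : ∀ k, y (k + 1) - y k = h := by intro k; simp only [hy]; push_cast; ring
    have hmono : Monotone y := monotone_nat_of_le_succ fun k => by linarith [hstep k]
    have hmem : ∀ k ≤ m + 1, y k ∈ Icc a b := fun k hk =>
      ⟨hy0 ▸ hmono (Nat.zero_le k), hyn ▸ hmono hk⟩
    have hgi : ∀ k < m + 1, IntervalIntegrable g volume (y k) (y (k + 1)) := fun k hk =>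
      hg.mono_set (by
        rw [uIcc_of_le (hmono (Nat.le_succ k)), uIcc_of_le hab]
        exact Icc_subset_Icc (hmem k hk.le).1 (hmem (k + 1) hk).2)
    have hint : ∀ k < m + 1, IntervalIntegrable (fun x => g x * Φ' x) volume (y k) (y (k + 1)) :=
      fun k hk => (hgi k hk).mul_continuousOn hΦ'.continuousOn
    have hsplit := intervalIntegral.sum_integral_adjacent_intervals hint
    rw [hy0, hyn] at hsplit
    -- Freezing g at the left endpoint of each piece leaves a Riemann–Stieltjes sum, handled by Abel
    -- summation. The error is at most the variation on the piece times M h, which totals W M h and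
    -- tends to 0 with the mesh.
    have hpiece : ∀ k < m + 1, ∫ x in y k..y (k + 1), g x * Φ' x =
        g (y k) * (Φ (y (k + 1)) - Φ (y k)) +
          ∫ x in y k..y (k + 1), (g x - g (y k)) * Φ' x := by
      intro k hk
      have h1 : ∫ x in y k..y (k + 1), g (y k) * Φ' x = g (y k) * (Φ (y (k + 1)) - Φ (y k)) := by
        rw [intervalIntegral.integral_const_mul, intervalIntegral.integral_eq_sub_of_hasDerivAt
          (fun x _ => hΦ x) (hΦ'.intervalIntegrable _ _)]
      have h2 : ∫ x in y k..y (k + 1), (g x - g (y k)) * Φ' x =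
          (∫ x in y k..y (k + 1), g x * Φ' x) - ∫ x in y k..y (k + 1), g (y k) * Φ' x := by
        simp_rw [sub_mul]
        exact intervalIntegral.integral_sub (hint k hk)
          ((continuous_const.mul hΦ').intervalIntegrable _ _)
      rw [h2, ← h1]; ring
    have herr : ∀ k ∈ Finset.range (m + 1),
        ‖∫ x in y k..y (k + 1), (g x - g (y k)) * Φ' x‖ ≤ (V (y (k + 1)) - V (y k)) * M * h := by
      intro k hk
      have hk' := Finset.mem_range.mp hk
      have h1 := intervalIntegral.norm_integral_le_of_norm_le_const (a := y k) (b := y (k + 1))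
        (f := fun x => (g x - g (y k)) * Φ' x) (C := (V (y (k + 1)) - V (y k)) * M) (by
        intro x hx
        rw [uIoc_of_le (hmono (Nat.le_succ k))] at hx
        have hxm : x ∈ Icc a b := ⟨(hmem k hk'.le).1.trans hx.1.le, hx.2.trans (hmem (k + 1) hk').2⟩
        rw [norm_mul]
        have h2 := hV _ (hmem k hk'.le) x hxm hx.1.le
        have h3 := (norm_nonneg _).trans (hV x hxm _ (hmem (k + 1) hk') hx.2)
        exact mul_le_mul (by linarith) (hM x hxm) (norm_nonneg _)
          (by linarith [(norm_nonneg _).trans h2]))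
      rwa [hstep, abs_of_nonneg hh0] at h1
    have habel : ∀ N : ℕ, ∑ k ∈ Finset.range N, g (y k) * (Φ (y (k + 1)) - Φ (y k)) =
        g (y N) * Φ (y N) - g (y 0) * Φ (y 0) -
          ∑ k ∈ Finset.range N, (g (y (k + 1)) - g (y k)) * Φ (y (k + 1)) := by
      intro N
      induction N with
      | zero => simp
      | succ N ih => rw [Finset.sum_range_succ, ih, Finset.sum_range_succ]; ring
    have hvar : ‖∑ k ∈ Finset.range (m + 1), (g (y (k + 1)) - g (y k)) * Φ (y (k + 1))‖ ≤ W * S := by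
      have h1 : ∀ k ∈ Finset.range (m + 1), ‖(g (y (k + 1)) - g (y k)) * Φ (y (k + 1))‖ ≤
          (V (y (k + 1)) - V (y k)) * S := by
        intro k hk
        have hk' := Finset.mem_range.mp hk
        have h2 := hV _ (hmem k hk'.le) _ (hmem (k + 1) hk') (hmono (Nat.le_succ k))
        rw [norm_mul]
        exact mul_le_mul h2 (hS _) (norm_nonneg _) ((norm_nonneg _).trans h2)
      refine (norm_sum_le_of_le _ h1).trans (le_of_eq ?_)
      rw [← Finset.sum_mul, Finset.sum_range_sub (fun k => V (y k)), hy0, hyn]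
    rw [← hsplit, Finset.sum_congr rfl fun k hk => hpiece k (Finset.mem_range.mp hk),
      Finset.sum_add_distrib, habel, hy0, hyn]
    have herr' : ‖∑ k ∈ Finset.range (m + 1), ∫ x in y k..y (k + 1), (g x - g (y k)) * Φ' x‖ ≤
        W * M * (b - a) / (m + 1) := by
      refine (norm_sum_le_of_le _ herr).trans (le_of_eq ?_)
      rw [← Finset.sum_mul, ← Finset.sum_mul, Finset.sum_range_sub (fun k => V (y k)), hy0, hyn, hh,
        mul_div_assoc]
    refine (norm_add_le _ _).trans (add_le_add ?_ herr')
    refine (norm_sub_le _ _).trans ?_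
    have h1 : ‖g b * Φ b - g a * Φ a‖ ≤ ‖g b‖ * S + ‖g a‖ * S := by
      refine (norm_sub_le _ _).trans ?_
      rw [norm_mul, norm_mul]
      exact add_le_add (mul_le_mul_of_nonneg_left (hS b) (norm_nonneg _))
        (mul_le_mul_of_nonneg_left (hS a) (norm_nonneg _))
    linarith
  have hlim : Filter.Tendsto
      (fun m : ℕ => (‖g a‖ + ‖g b‖ + W) * S + W * M * (b - a) / ((m : ℝ) + 1)) Filter.atTop
      (nhds ((‖g a‖ + ‖g b‖ + W) * S + 0)) := by
    refine Filter.Tendsto.const_add _ (Filter.Tendsto.const_div_atTop ?_ _)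
    exact Filter.tendsto_atTop_add_const_right _ _ tendsto_natCast_atTop_atTop
  rw [add_zero] at hlim
  exact ge_of_tendsto' hlim key

theorem norm_sub_le_variationOnFromTo {g : ℝ → ℂ} {a b : ℝ}
    (hg : BoundedVariationOn g (Icc a b)) :
    ∀ x ∈ Icc a b, ∀ y ∈ Icc a b, x ≤ y →
      ‖g y - g x‖ ≤ variationOnFromTo g (Icc a b) a y - variationOnFromTo g (Icc a b) a x := by
  intro x hx y hy hxy
  have ha : a ∈ Icc a b := left_mem_Icc.mpr (hx.1.trans hx.2)
  have h1 := variationOnFromTo.add hg.locallyBoundedVariationOn ha hx hy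
  have h2 : ‖g y - g x‖ ≤ variationOnFromTo g (Icc a b) x y := by
    rw [variationOnFromTo.eq_of_le _ _ hxy, ← dist_eq_norm, dist_edist]
    refine ENNReal.toReal_mono (hg.locallyBoundedVariationOn x y hx hy) ?_
    exact eVariationOn.edist_le g ⟨hy, right_mem_Icc.mpr hxy⟩ ⟨hx, left_mem_Icc.mpr hxy⟩
  linarith

/-- If the symmetric partial sums of the Fourier series along a sequence of scales have summable
increments, then the function is continuous and periodic. -/
theorem exists_continuous_of_summable_increments {z : L2Space} {X : ℕ → ℕ} (hX : Monotone X)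
    (htend : Filter.Tendsto X Filter.atTop Filter.atTop) {ε : ℕ → ℝ} (hε : Summable ε)
    (hb : ∀ i x, ‖∑ n ∈ Finset.Ico (X i) (X (i + 1)),
      (modeCoeff z n * fourierMode n x + modeCoeff z (-n) * fourierMode (-n) x)‖ ≤ ε i) :
    ∃ f : ℝ → ℂ, Continuous f ∧ f 0 = f (2 * Real.pi) ∧ (z : ℝ → ℂ) =ᵐ[spaceMeasure] f := by
  set a : ℤ → ℂ := fun j => modeCoeff z j with ha
  set c : ℂ := ((2 * Real.pi : ℝ) : ℂ)⁻¹ with hc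
  set T : ℕ → ℝ → ℂ := fun n x => a n * fourierMode n x + a (-n) * fourierMode (-n) x with hT
  -- The pairing of n with -n counts the zero mode twice, whence the subtraction.
  set P : ℕ → ℝ → ℂ := fun N x => c * (∑ n ∈ Finset.range N, T n x - a 0 * fourierMode 0 x) with hP
  have hTc : ∀ n, Continuous (T n) := fun n =>
    (continuous_const.mul (continuous_fourierMode _)).add
      (continuous_const.mul (continuous_fourierMode _))
  have hPc : ∀ N, Continuous (P N) := fun N =>
    continuous_const.mul ((continuous_finsetSum _ fun n _ => hTc n).sub
      (continuous_const.mul (continuous_fourierMode _)))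
  have hTper : ∀ n, T n 0 = T n (2 * Real.pi) := by
    intro n
    simp only [hT, fourierMode_zero_right, fourierMode_two_pi]
  have hPper : ∀ N, P N 0 = P N (2 * Real.pi) := by
    intro N
    simp only [hP, hTper, fourierMode_zero_right, fourierMode_two_pi]
  -- the uniform limit
  set D : ℕ → ℝ → ℂ := fun i x => P (X (i + 1)) x - P (X i) x with hD
  have hDb : ∀ i x, ‖D i x‖ ≤ ‖c‖ * ε i := by
    intro i x
    have e1 : D i x = c * ∑ n ∈ Finset.Ico (X i) (X (i + 1)), T n x := by
      simp only [hD, hP]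
      rw [Finset.sum_Ico_eq_sub _ (hX (Nat.le_succ i))]
      ring
    rw [e1, norm_mul]
    exact mul_le_mul_of_nonneg_left (hb i x) (norm_nonneg _)
  have hsum := hε.mul_left ‖c‖
  set f : ℝ → ℂ := fun x => P (X 0) x + ∑' i, D i x with hf
  have hfc : Continuous f :=
    (hPc _).add (continuous_tsum (fun i => (hPc _).sub (hPc _)) hsum hDb)
  have hlim : ∀ x, Filter.Tendsto (fun i => P (X i) x) Filter.atTop (nhds (f x)) := by
    intro x
    have h1 : Summable fun i => D i x := Summable.of_norm_bounded hsum fun i => hDb i x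
    have h2 := (h1.hasSum.tendsto_sum_nat).const_add (P (X 0) x)
    refine h2.congr fun i => ?_
    rw [Finset.sum_range_sub (fun i => P (X i) x)]
    ring
  refine ⟨f, hfc, ?_, ?_⟩
  · refine tendsto_nhds_unique (hlim 0) ((hlim (2 * Real.pi)).congr fun i => (hPper _).symm)
  -- convergence in `L²`
  have hser : HasSum (fun j => (c * a j) • modeLp j) z := by
    refine (modeBasis.hasSum_repr z).congr_fun ?_ |> id
    intro j
    have h2 : ((2 * Real.pi : ℝ) : ℂ) =
        ((Real.sqrt (2 * Real.pi) : ℝ) : ℂ) * (Real.sqrt (2 * Real.pi) : ℝ) := by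
      rw [← Complex.ofReal_mul, Real.mul_self_sqrt Real.two_pi_pos.le]
    rw [modeBasis_repr, modeBasis_apply, smul_smul, hc, h2, mul_inv]
    congr 1; ring
  have hN := hser.nat_add_neg.tendsto_sum_nat.sub_const ((c * a 0) • modeLp 0)
  rw [add_sub_cancel_right] at hN
  set PL : ℕ → L2Space := fun N => ∑ n ∈ Finset.range N,
    ((c * a n) • modeLp n + (c * a (-n)) • modeLp (-n)) - (c * a 0) • modeLp 0 with hPL
  have hcoe : ∀ j, ((c * a j) • modeLp j : L2Space) =ᵐ[spaceMeasure]
      fun x => c * a j * fourierMode j x := by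
    intro j
    filter_upwards [Lp.coeFn_smul (c * a j) (modeLp j), coeFn_modeLp j] with x h1 h2
    rw [h1, Pi.smul_apply, h2, smul_eq_mul]
  have hPLsum : ∀ N, (∑ n ∈ Finset.range N, ((c * a n) • modeLp n + (c * a (-n)) • modeLp (-n)) :
      L2Space) =ᵐ[spaceMeasure] fun x => c * ∑ n ∈ Finset.range N, T n x := by
    intro N
    induction N with
    | zero =>
      simp only [Finset.range_zero, Finset.sum_empty, mul_zero]
      exact Lp.coeFn_zero _ _ _
    | succ N ih =>
      simp only [Finset.sum_range_succ]
      filter_upwards [Lp.coeFn_add (∑ n ∈ Finset.range N,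
          ((c * a n) • modeLp n + (c * a (-n)) • modeLp (-n)))
          ((c * a N) • modeLp N + (c * a (-N)) • modeLp (-N)),
        Lp.coeFn_add ((c * a N) • modeLp N) ((c * a (-N)) • modeLp (-N)), ih, hcoe N, hcoe (-N)]
        with x h1 h2 h3 h4 h5
      rw [h1, Pi.add_apply, h2, Pi.add_apply, h3, h4, h5]
      simp only [hT]
      ring
  have hPLae : ∀ N, PL N =ᵐ[spaceMeasure] P N := by
    intro N
    filter_upwards [Lp.coeFn_sub (∑ n ∈ Finset.range N,
        ((c * a n) • modeLp n + (c * a (-n)) • modeLp (-n))) ((c * a 0) • modeLp 0),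
      hPLsum N, hcoe 0] with x h1 h2 h3
    rw [h1, Pi.sub_apply, h2, h3]
    simp only [hP]
    ring
  -- The L² limit z is attained almost everywhere along a subsequence of the scales, where the
  -- uniform limit f is attained as well.
  have hmeas := (tendstoInMeasure_of_tendsto_Lp (hN.comp htend))
  obtain ⟨ns, hns, hae⟩ := hmeas.exists_seq_tendsto_ae
  filter_upwards [hae, ae_all_iff.mpr hPLae] with x h1 h2
  refine tendsto_nhds_unique h1 (((hlim x).comp hns.tendsto_atTop).congr fun i => ?_)
  exact (h2 (X (ns i))).symm

/-- The block is the convolution of g with a trigonometric polynomial whose primitive is, up to the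
factor i, the symmetric sum. Integration by parts moves the derivative onto g. -/
theorem norm_sum_mul_modeCoeff_le_of_variation {g : ℝ → ℂ} (hg : Integrable g spaceMeasure)
    (hBV : BoundedVariationOn g (Icc 0 (2 * Real.pi))) (m : ℤ → ℂ) {X₁ X₂ : ℕ} (hX : 0 < X₁)
    {S : ℝ} (hS : ∀ x, ‖symmSum (fun j => m j * fourierMode j x) X₁ X₂‖ ≤ S) (x : ℝ) :
    ‖∑ n ∈ Finset.Ico X₁ X₂, (m n * modeCoeff g n * fourierMode n x +
        m (-n) * modeCoeff g (-n) * fourierMode (-n) x)‖ ≤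
      (‖g 0‖ + ‖g (2 * Real.pi)‖ + (variationOnFromTo g (Icc 0 (2 * Real.pi)) 0 (2 * Real.pi) -
        variationOnFromTo g (Icc 0 (2 * Real.pi)) 0 0)) * S := by
  have hmode : ∀ (j : ℤ) (y : ℝ), HasDerivAt (fun y => fourierMode j (x - y))
      (-(Complex.I * j * fourierMode j (x - y))) y := fun j y => by
    simpa using (hasDerivAt_fourierMode j (x - y)).comp_const_sub x y
  -- The y-derivative of the j-th mode at x - y carries the factor -ij. The factor i cancels it
  -- after division by j, and the minus sign in `symmSum` accounts for dividing the frequency -n by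
  -- n.
  set Φ : ℝ → ℂ := fun y => Complex.I * symmSum (fun j => m j * fourierMode j (x - y)) X₁ X₂ with hΦ
  set Φ' : ℝ → ℂ := fun y => ∑ n ∈ Finset.Ico X₁ X₂,
    (m n * fourierMode n (x - y) + m (-n) * fourierMode (-n) (x - y)) with hΦ'
  have hder : ∀ y, HasDerivAt Φ (Φ' y) y := by
    intro y
    have h1 : HasDerivAt (fun y => ∑ n ∈ Finset.Ico X₁ X₂,
        (m n * fourierMode n (x - y) - m (-n) * fourierMode (-n) (x - y)) / (n : ℂ))
        (∑ n ∈ Finset.Ico X₁ X₂, (m n * -(Complex.I * (n : ℤ) * fourierMode n (x - y)) -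
          m (-n) * -(Complex.I * (-(n : ℤ) : ℤ) * fourierMode (-n) (x - y))) / (n : ℂ)) y :=
      HasDerivAt.fun_sum fun n _ =>
        (((hmode n y).const_mul _).sub ((hmode (-n) y).const_mul _)).div_const _
    refine (h1.const_mul Complex.I).congr_deriv ?_
    rw [Finset.mul_sum]
    refine Finset.sum_congr rfl fun n hn => ?_
    have hn0 : (n : ℂ) ≠ 0 := by
      exact_mod_cast (hX.trans_le (Finset.mem_Ico.mp hn).1).ne'
    field_simp
    push_cast
    ring_nf
    rw [Complex.I_sq]
    ring
  have hcont : Continuous Φ' := continuous_finsetSum _ fun n _ =>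
    (continuous_const.mul ((continuous_fourierMode _).comp (continuous_const.sub continuous_id))).add
      (continuous_const.mul ((continuous_fourierMode _).comp (continuous_const.sub continuous_id)))
  have hcoef : ∀ j : ℤ, Integrable (fun y => g y * (m j * fourierMode j (x - y))) spaceMeasure ∧
      ∫ y in Ioc 0 (2 * Real.pi), g y * (m j * fourierMode j (x - y)) =
        m j * modeCoeff g j * fourierMode j x := by
    intro j
    have e : (fun y => g y * (m j * fourierMode j (x - y))) =
        fun y => (m j * fourierMode j x) * (g y * (starRingEnd ℂ) (fourierMode j y)) := by
      funext y
      have : fourierMode j (x - y) = fourierMode j x * (starRingEnd ℂ) (fourierMode j y) := by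
        rw [sub_eq_add_neg, fourierMode_add_right, conj_fourierMode]
        congr 1
        simp [fourierMode]
      rw [this]; ring
    rw [e]
    refine ⟨(integrable_mul_conj_fourierMode hg j).const_mul _, ?_⟩
    rw [integral_const_mul, modeCoeff]
    ring
  have hint : ∑ n ∈ Finset.Ico X₁ X₂, (m n * modeCoeff g n * fourierMode n x +
      m (-n) * modeCoeff g (-n) * fourierMode (-n) x) = ∫ y in (0 : ℝ)..(2 * Real.pi), g y * Φ' y := by
    rw [intervalIntegral.integral_of_le Real.two_pi_pos.le]
    simp only [hΦ', Finset.mul_sum, mul_add]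
    have hi : ∀ n ∈ Finset.Ico X₁ X₂, Integrable (fun y => g y * (m n * fourierMode n (x - y)) +
        g y * (m (-n) * fourierMode (-n) (x - y))) spaceMeasure := fun n _ =>
      (hcoef n).1.add (hcoef (-n)).1
    rw [integral_finsetSum _ hi]
    refine Finset.sum_congr rfl fun n _ => ?_
    rw [integral_add (hcoef n).1 (hcoef (-n)).1, (hcoef n).2, (hcoef (-n)).2]
  rw [hint]
  refine norm_integral_mul_deriv_le_of_variation Real.two_pi_pos.le
    ((intervalIntegrable_iff_integrableOn_Ioc_of_le Real.two_pi_pos.le).mpr hg)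
    (norm_sub_le_variationOnFromTo hBV) hder hcont fun y => ?_
  rw [hΦ, norm_mul, Complex.norm_I, one_mul]
  exact hS (x - y)

theorem exists_continuous_of_irrational {e : ℕ} (he : 1 ≤ e) (α : ℕ → ℤ) (p : ℕ) {q : ℕ}
    (hq : 0 < q) (hB : phaseMultiplier e α p q ≠ 0) {θ : ℝ} (hθ : θ ∈ Set.Ioo (0 : ℝ) 1)
    (hirr : Irrational θ) {z₀ z : L2Space}
    (hz : ∀ j, modeCoeff z j = unitExp (modePhase e α p q θ j) * modeCoeff z₀ j) {g : ℝ → ℂ}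
    (hBV : BoundedVariationOn g (Icc 0 (2 * Real.pi))) (hg : (z₀ : ℝ → ℂ) =ᵐ[spaceMeasure] g) :
    ∃ f : ℝ → ℂ, Continuous f ∧ f 0 = f (2 * Real.pi) ∧ (z : ℝ → ℂ) =ᵐ[spaceMeasure] f := by
  obtain ⟨X, ε, hX, htend, hpos, hε, hb⟩ := exists_scales he α p hq hB hθ hirr
  have hgi : Integrable g spaceMeasure :=
    ((Lp.memLp z₀).integrable (by norm_num)).congr hg
  refine exists_continuous_of_summable_increments hX htend (hε.mul_left
    (‖g 0‖ + ‖g (2 * Real.pi)‖ + (variationOnFromTo g (Icc 0 (2 * Real.pi)) 0 (2 * Real.pi) -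
        variationOnFromTo g (Icc 0 (2 * Real.pi)) 0 0))) fun i x => ?_
  have h := norm_sum_mul_modeCoeff_le_of_variation hgi hBV
    (fun j => unitExp (modePhase e α p q θ j)) (hpos i) (S := ε i) (X₂ := X (i + 1)) (fun y => by
      simp_rw [fourierMode_eq_unitExp]
      exact hb i (y / (2 * Real.pi))) x
  simpa only [hz, modeCoeff_congr_ae hg] using h

/-! ### The main theorem -/

theorem theorem2 (θ : ℝ) (hθ : θ ∈ Set.Ioo (0 : ℝ) 1) (n : ℕ) (hn : 3 ≤ n)
    (α : ℕ → ℤ) (hα : α n ≠ 0) (p q : ℕ) (hp : 0 < p) (hq : 0 < q) (hpq : Nat.Coprime p q) :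
    -- the periodic problem is well posed, so that "the solution" makes sense
    (∀ z₀ : L2Space, ∃ z : ℝ → L2Space, IsPeriodicSolution n (polyA n α θ) z₀ z ∧
      ∀ w : ℝ → L2Space, IsPeriodicSolution n (polyA n α θ) z₀ w → ∀ t : ℝ, 0 ≤ t → w t = z t) ∧
    -- (i)
    (θ ∈ Set.range ((↑) : ℚ → ℝ) →
      ∃ (N : ℕ) (c : Fin N → ℂ) (s : Fin N → ℝ),
        ∀ (z₀ : L2Space) (z : ℝ → L2Space), IsPeriodicSolution n (polyA n α θ) z₀ z →
          (z (2 * Real.pi * ((p : ℝ) / (q : ℝ))) : ℝ → ℂ) =ᵐ[spaceMeasure]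
            fun x => ∑ j, c j * periodicTranslate (s j) z₀ x) ∧
    -- (ii)
    (Irrational θ →
      ∀ (z₀ : L2Space) (z : ℝ → L2Space), IsPeriodicSolution n (polyA n α θ) z₀ z →
        (∃ g : ℝ → ℂ, BoundedVariationOn g (Set.Icc 0 (2 * Real.pi)) ∧
          (z₀ : ℝ → ℂ) =ᵐ[spaceMeasure] g) →
        ∃ f : ℝ → ℂ, ContinuousOn f (Set.Icc 0 (2 * Real.pi)) ∧ f 0 = f (2 * Real.pi) ∧
          (z (2 * Real.pi * ((p : ℝ) / (q : ℝ))) : ℝ → ℂ) =ᵐ[spaceMeasure] f) := by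

  obtain ⟨e, rfl⟩ : ∃ e, n = e + 2 := ⟨n - 2, by omega⟩
  have ht : 0 ≤ 2 * Real.pi * ((p : ℝ) / (q : ℝ)) := by positivity
  have hcoef : ∀ (z₀ : L2Space) (z : ℝ → L2Space),
      IsPeriodicSolution (e + 2) (polyA (e + 2) α θ) z₀ z → ∀ j,
        modeCoeff (z (2 * Real.pi * ((p : ℝ) / (q : ℝ)))) j =
          unitExp (modePhase e α p q θ j) * modeCoeff z₀ j := fun z₀ z hz j => by
    rw [hz.modeCoeff_eq ht, phaseFactor_rational_time]
  refine ⟨fun z₀ => ⟨evolve (polyA (e + 2) α θ) z₀,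
    isPeriodicSolution_evolve (natDegree_polyA_le _ _ _) z₀, fun w hw t h0 =>
      L2Space.ext_modeCoeff fun j => ?_⟩, fun hrat => ?_, fun hirr z₀ z hz hg => ?_⟩
  · rw [hw.modeCoeff_eq h0, modeCoeff_evolve]
  · obtain ⟨N, c, s, h⟩ := exists_translates_of_rational e α p hq hrat
    exact ⟨N, c, s, fun z₀ z hz => h z₀ _ (hcoef z₀ z hz)⟩
  · obtain ⟨g, hBV, hg⟩ := hg
    have hB : phaseMultiplier e α p q ≠ 0 := by
      have := Nat.factorial_ne_zero (e + 2)
      simp [phaseMultiplier, hp.ne', hq.ne', hα, this]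
    obtain ⟨f, hf, hf0, hzf⟩ := exists_continuous_of_irrational (by omega) α p hq hB hθ hirr
      (hcoef z₀ z hz) hBV hg
    exact ⟨f, hf.continuousOn, hf0, hzf⟩
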